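/- **Setting.** For a finite region $\Omega$ of a lattice $\mathcal L$ (either $\mathbb Z^s$ or a torus $\mathbb Z_m^s$, $m\ge 1$) with cells of dimension $d$, let $\mathsf A(\Omega)=\bigotimes_{x\in\Omega}\mathsf M_d(\mathbb C)$, and let $\mathsf A(\mathcal L)$ be the quasi-local algebra (the $C^*$-completion of the union of the $\mathsf A(\Omega)$; a full matrix algebra if $\mathcal L$ is finite), with shifts $\tau_x$. A *QCA* on $\mathcal L$ with finite neighbourhood scheme $\mathcal N\subset\mathcal L$ is a $*$-automorphism $T$ of $\mathsf A(\mathcal L)$ with $T(\mathsf A(\Omega))\subset\mathsf A(\Omega+\mathcal N)$ for every finite $\Omega$ and $T\tau_x=\tau_xT$ for every $x$. Then $T^N$ has the neighbourhood scheme $\mathcal N^{(N)}=\mathcal N+\dots+\mathcal N$ ($N$ summands). Let $\varphi:\mathbb Z^s\to\mathbb Z_m^s$ be reduction modulo $m$. A set $\mathcal N\subset\mathbb Z^s$ is *regular over $\mathbb Z_m^s$* if, with $\mathcal N_x=x+\mathcal N$, $$\varphi^{-1}(\varphi(\mathcal N_x))\cap\varphi^{-1}(\varphi(\mathcal N_y))\cap(\mathcal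 N_x\cup\mathcal N_y)=\mathcal N_x\cap\mathcal N_y\quad\text{whenever }\mathcal N_x\cap\mathcal N_y\ne\emptyset .$$ If the neighbourhood scheme $\mathcal N$ of a QCA $T$ on $\mathbb Z^s$ is regular over $\mathbb Z_m^s$, the *wrapped evolution* $T_w$ is the QCA on $\mathbb Z_m^s$ with scheme $\varphi(\mathcal N)$ and the same transition rule: if $T$ maps an operator $a$ on the cell $0$ to $M\in\mathsf A(\mathcal N)$, then $T_w$ maps $a$ on the cell $0$ to the copy of $M$ on the cells $\varphi(\mathcal N)$. Let $N\ge1$, $\Lambda_0=[0,N-1]^s$ and $\Lambda_y=\Lambda_0+Ny$. The *tile neighbourhood* of $T^N$ is $\mathcal N'=\{y\in\mathbb Z^s:(\Lambda_0+\mathcal N^{(N)})\cap\Lambda_y\neq\emptyset\}$. We call the neighbourhood of $T^N$ *regular over* $\mathbb Z_{Nf}^s$ ($f\ge1$) if $\mathcal N^{(N)}$ is regular over $\mathbb Z_{Nf}^s$ and $\mathcal N'$ is regular over the lattice of tiles $\mathbb Z_f^s$. Let $\Pi_0\in\mathsf A(\Lambda_0)$ be a projection of rank $d'$, let $\psi_0,\dots,\psi_{d'-1}$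 be an orthonormal basis of its range, and put $J_0=\sum_k|k\rangle\langle\psi_k|$. On $\mathbb Z_{Nf}^s$, whose tiles $\Lambda_x$ are labelled by $x\in\mathbb Z_f^s$, let $\Pi=\bigotimes_x\Pi_x$ and $J=\bigotimes_xJ_{\Lambda_x}$ be the tensor products of the translates of $\Pi_0$ and $J_0$, and let $\mathcal V:\mathsf A(\mathbb Z_f^s)\to\mathsf A(\mathbb Z_{Nf}^s)$, $\mathcal V(A)=J^\dagger AJ$, the cells of $\mathbb Z_f^s$ having dimension $d'$. A QCA $S$ on $\mathbb Z^s$ with cells of dimension $d'$ is a *size-$N$ renormalisation of $T$ through $(\Pi_0,\Lambda_0)$* if, for every $f\ge1$ such that the neighbourhood of $T^N$ is regular over $\mathbb Z_{Nf}^s$, the wrapped evolutions $T_w$ on $\mathbb Z_{Nf}^s$ and $S_w$ on $\mathbb Z_f^s$ are defined and $T_w^N\circ\mathcal V=\mathcal V\circ S_w$. **Proposition.** Let $T$ be a QCA on $\mathbb Z^s$ with cells of dimension $d\ge2$, let $N\ge1$, and let $\Pi_0\in\mathsf A(\Lambda_0)$ be a projection; fix any orthonormal basis of its range as above. The following are equivalent: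 1. there is a QCA $S$ on $\mathbb Z^s$ that is a size-$N$ renormalisation of $T$ through $(\Pi_0,\Lambda_0)$; 2. there is $f\ge1$ such that the neighbourhood of $T^N$ is regular over $\mathbb Z_{Nf}^s$ and $[U,\Pi]=0$, where $U$ is the unitary (unique up to a phase) with $T_w^N(A)=U^\dagger AU$ for all $A\in\mathsf A(\mathbb Z_{Nf}^s)$. -/

import Mathlib

open scoped Pointwise Matrix ENNReal

noncomputable section

namespace QCAutomata

/-! ### Configurations and the quasi-local algebra -/

/-- Classical configurations of a lattice `L` whose cells have dimension `d`; they label the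
product basis. -/
abbrev Config (L : Type) (d : ℕ) : Type := L → Fin d

/-- The Hilbert space with orthonormal basis labelled by all configurations. It carries a faithful
representation of all local operators, and is used for the quasi-local algebra. -/
abbrev HSpace (L : Type) (d : ℕ) : Type := lp (fun _ : Config L d => ℂ) 2

/-- Bounded operators on `HSpace L d`. -/
abbrev BOp (L : Type) (d : ℕ) : Type := HSpace L d →L[ℂ] HSpace L d

theorem sum_pull_le {ι : Type} (P : Set ι) (σ : ι → ι) (hσ : Set.InjOn σ P)
    (ψ : lp (fun _ : ι => ℂ) 2) (t : Finset ι) :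
    ∑ c ∈ t, ‖P.indicator (fun c => ψ (σ c)) c‖ ^ (2 : ℝ≥0∞).toReal
      ≤ ‖ψ‖ ^ (2 : ℝ≥0∞).toReal := by
  classical
  have h1 : ∑ c ∈ t, ‖P.indicator (fun c => ψ (σ c)) c‖ ^ (2 : ℝ≥0∞).toReal
      = ∑ c ∈ t with c ∈ P, ‖ψ (σ c)‖ ^ (2 : ℝ≥0∞).toReal := by
    rw [Finset.sum_filter]
    refine Finset.sum_congr rfl fun c _ => ?_
    by_cases hc : c ∈ P <;> simp [hc]
  rw [h1, ← Finset.sum_image (f := fun c => ‖ψ c‖ ^ (2 : ℝ≥0∞).toReal) (g := σ)]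
  · exact lp.sum_rpow_le_norm_rpow (by norm_num) ψ _
  · intro a ha b hb h
    exact hσ (by simpa using (Finset.mem_filter.1 ha).2) (by simpa using (Finset.mem_filter.1 hb).2) h

/-- The partial isometry `(V ψ)(c) = ψ (σ c)` for `c ∈ P`, and `(V ψ)(c) = 0` otherwise, for a map
`σ` that is injective on `P`. -/
def pull {ι : Type} (P : Set ι) (σ : ι → ι) (hσ : Set.InjOn σ P) :
    lp (fun _ : ι => ℂ) 2 →L[ℂ] lp (fun _ : ι => ℂ) 2 :=
  LinearMap.mkContinuous
    { toFun := fun ψ => ⟨P.indicator (fun c => ψ (σ c)), memℓp_gen' (sum_pull_le P σ hσ ψ)⟩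
      map_add' := fun ψ χ => by
        ext c
        change P.indicator (fun c => ψ (σ c) + χ (σ c)) c
          = P.indicator (fun c => ψ (σ c)) c + P.indicator (fun c => χ (σ c)) c
        by_cases hc : c ∈ P <;> simp [hc]
      map_smul' := fun z ψ => by
        ext c
        by_cases hc : c ∈ P <;> simp [hc] } 1
    (fun ψ => by
      rw [one_mul]
      exact lp.norm_le_of_forall_sum_le (by norm_num) (norm_nonneg _) (sum_pull_le P σ hσ ψ))

theorem pull_apply {ι : Type} (P : Set ι) (σ : ι → ι) (hσ : Set.InjOn σ P)
    (ψ : lp (fun _ : ι => ℂ) 2) (c : ι) :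
    pull P σ hσ ψ c = P.indicator (fun c => ψ (σ c)) c := rfl

theorem extend_injOn {L κ : Type} {d : ℕ} (g : κ ↪ L) (a b : κ → Fin d) :
    Set.InjOn (fun c : Config L d => Function.extend g b c) {c | c ∘ g = a} := by
  intro c hc c' hc' h
  funext x
  by_cases hx : ∃ k, g k = x
  · obtain ⟨k, rfl⟩ := hx
    exact (congrFun hc k).trans (congrFun hc' k).symm
  · have := congrFun h x
    simpa [Function.extend_apply' _ _ _ hx] using this

/-- The operator `M ⊗ I` on `HSpace L d`: the matrix `M` acts on the cells `g k`, `k : κ`, and the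
identity on all other cells. It is written as `∑ a b, M a b • (|a⟩⟨b| ⊗ I)`. -/
def siteOp {L κ : Type} [Fintype κ] [DecidableEq κ] {d : ℕ} (g : κ ↪ L)
    (M : Matrix (κ → Fin d) (κ → Fin d) ℂ) : BOp L d :=
  ∑ a : κ → Fin d, ∑ b : κ → Fin d,
    M a b • pull {c : Config L d | c ∘ g = a} (fun c => Function.extend g b c)
      (extend_injOn g a b)

/-- The inclusion of a finite region in the lattice. -/
abbrev regionEmb {L : Type} (Ω : Finset L) : {x // x ∈ Ω} ↪ L := Function.Embedding.subtype _

/-- The algebra `A(Ω)` of operators on the finite region `Ω`, inside the bounded operators. -/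
def localOps {L : Type} [DecidableEq L] (d : ℕ) (Ω : Finset L) : Set (BOp L d) :=
  Set.range (siteOp (d := d) (regionEmb Ω))

/-- The quasi-local algebra `A(L)`: the norm closure of the `*`-algebra of local operators. -/
def quasiLocal (L : Type) [DecidableEq L] (d : ℕ) : StarSubalgebra ℂ (BOp L d) :=
  (StarAlgebra.adjoin ℂ (⋃ Ω : Finset L, localOps d Ω)).topologicalClosure

/-- A matrix on a finite region as an element of the quasi-local algebra. -/
def regionOp {L : Type} [DecidableEq L] {d : ℕ} (Ω : Finset L)
    (M : Matrix ({x // x ∈ Ω} → Fin d) ({x // x ∈ Ω} → Fin d) ℂ) : quasiLocal L d :=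
  ⟨siteOp (regionEmb Ω) M, StarSubalgebra.le_topologicalClosure _
    (StarAlgebra.subset_adjoin ℂ _ (Set.mem_iUnion.2 ⟨Ω, M, rfl⟩))⟩

/-- The unitary that moves the content of each cell `y` to the cell `y + x`. -/
def shiftOp {L : Type} [AddCommGroup L] {d : ℕ} (x : L) : BOp L d :=
  pull Set.univ (fun c : Config L d => fun y => c (y + x)) (by
    intro c _ c' _ h
    funext y
    simpa using congrFun h (y - x))

theorem shiftOp_apply {L : Type} [AddCommGroup L] {d : ℕ} (x : L) (ψ : HSpace L d)
    (c : Config L d) : shiftOp x ψ c = ψ (fun y => c (y + x)) :=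
  (pull_apply _ _ _ ψ c).trans (Set.indicator_of_mem (Set.mem_univ _) _)

theorem siteOp_apply {L κ : Type} [Fintype κ] [DecidableEq κ] {d : ℕ} (g : κ ↪ L)
    (M : Matrix (κ → Fin d) (κ → Fin d) ℂ) (ψ : HSpace L d) (c : Config L d) :
    siteOp g M ψ c = ∑ b : κ → Fin d, M (c ∘ g) b * ψ (Function.extend g b c) := by
  classical
  have h : siteOp g M ψ c = ∑ a : κ → Fin d, ∑ b : κ → Fin d, M a b *
      (if c ∘ g = a then ψ (Function.extend g b c) else 0) := by
    simp only [siteOp, sum_apply, lp.coeFn_sum, Finset.sum_apply]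
    refine Finset.sum_congr rfl fun a _ => Finset.sum_congr rfl fun b _ => ?_
    change M a b * pull _ _ _ ψ c = _
    rw [pull_apply]
    simp [Set.indicator_apply]
  rw [h, Finset.sum_comm]
  refine Finset.sum_congr rfl fun b _ => ?_
  simp

theorem shiftOp_mul_neg {L : Type} [AddCommGroup L] {d : ℕ} (x : L) :
    (shiftOp (-x) * shiftOp x : BOp L d) = 1 := by
  ext ψ c
  change shiftOp (-x) (shiftOp x ψ) c = ψ c
  rw [shiftOp_apply, shiftOp_apply]
  simp

theorem star_shiftOp {L : Type} [AddCommGroup L] {d : ℕ} (x : L) :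
    star (shiftOp x : BOp L d) = shiftOp (-x) := by
  rw [ContinuousLinearMap.star_eq_adjoint, eq_comm, ContinuousLinearMap.eq_adjoint_iff]
  intro ψ χ
  rw [lp.inner_eq_tsum, lp.inner_eq_tsum]
  let e : Config L d ≃ Config L d :=
    { toFun := fun c y => c (y + x)
      invFun := fun c y => c (y - x)
      left_inv := fun c => by simp
      right_inv := fun c => by simp }
  rw [← Equiv.tsum_eq e]
  refine tsum_congr fun c => ?_
  rw [shiftOp_apply, shiftOp_apply]
  simp [e]

theorem shift_siteOp {L : Type} [AddCommGroup L] [DecidableEq L] {d : ℕ} (x : L) (Ω : Finset L)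
    (M : Matrix ({y // y ∈ Ω} → Fin d) ({y // y ∈ Ω} → Fin d) ℂ) :
    shiftOp x * siteOp (regionEmb Ω) M * shiftOp (-x) ∈ localOps d (Ω + {x}) := by
  let e : {y // y ∈ Ω} ≃ {y // y ∈ Ω + {x}} :=
    { toFun := fun y => ⟨y.1 + x, Finset.add_mem_add y.2 (Finset.mem_singleton_self x)⟩
      invFun := fun y => ⟨y.1 - x, by
        obtain ⟨a, ha, b, hb, h⟩ := Finset.mem_add.1 y.2
        rw [Finset.mem_singleton] at hb
        subst hb
        rwa [← h, add_sub_cancel_right]⟩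
      left_inv := fun y => by simp
      right_inv := fun y => by simp }
  refine ⟨M.submatrix (fun k => k ∘ e) (fun k => k ∘ e), ?_⟩
  ext ψ c
  change _ = shiftOp x (siteOp (regionEmb Ω) M (shiftOp (-x) ψ)) c
  rw [siteOp_apply, shiftOp_apply, siteOp_apply]
  refine Fintype.sum_equiv (Equiv.arrowCongr e.symm (Equiv.refl _)) _ _ fun b => ?_
  rw [shiftOp_apply]
  refine congrArg₂ (· * ·) rfl (congrArg ψ ?_)
  funext z
  by_cases hz : z ∈ Ω + {x}
  · have h1 : Function.extend (regionEmb (Ω + {x})) b c z = b ⟨z, hz⟩ :=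
      (regionEmb (Ω + {x})).injective.extend_apply b c ⟨z, hz⟩
    rw [h1]
    have h2 : z + -x = regionEmb Ω (e.symm ⟨z, hz⟩) := sub_eq_add_neg z x ▸ rfl
    rw [h2, (regionEmb Ω).injective.extend_apply]
    simp
  · rw [Function.extend_apply', Function.extend_apply']
    · simp
    · rintro ⟨y, hy⟩
      apply hz
      have : z = y.1 + x := by
        have : y.1 = z + -x := hy
        rw [this]; simp
      exact this ▸ Finset.add_mem_add y.2 (Finset.mem_singleton_self x)
    · rintro ⟨y, hy⟩
      exact hz (hy ▸ y.2)

theorem shift_mem {L : Type} [AddCommGroup L] [DecidableEq L] {d : ℕ} (x : L)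
    (a : quasiLocal L d) : shiftOp x * a.1 * shiftOp (-x) ∈ quasiLocal L d := by
  have key : Set.MapsTo (fun a : BOp L d => shiftOp x * a * shiftOp (-x))
      (StarAlgebra.adjoin ℂ (⋃ Ω : Finset L, localOps d Ω))
      (StarAlgebra.adjoin ℂ (⋃ Ω : Finset L, localOps d Ω)) := by
    intro a ha
    change shiftOp x * a * shiftOp (-x) ∈ StarAlgebra.adjoin ℂ (⋃ Ω : Finset L, localOps d Ω)
    induction ha using StarAlgebra.adjoin_induction with
    | mem a ha =>
      obtain ⟨Ω, M, rfl⟩ := Set.mem_iUnion.1 ha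
      exact StarAlgebra.subset_adjoin ℂ _ (Set.mem_iUnion.2 ⟨_, shift_siteOp x Ω M⟩)
    | algebraMap r =>
      have h := shiftOp_mul_neg (d := d) (-x)
      rw [neg_neg] at h
      rw [← Algebra.commutes, mul_assoc, h, mul_one]
      exact algebraMap_mem _ r
    | add a b _ _ iha ihb =>
      rw [mul_add, add_mul]
      exact add_mem iha ihb
    | mul a b _ _ iha ihb =>
      have : shiftOp x * (a * b) * shiftOp (-x)
          = shiftOp x * a * shiftOp (-x) * (shiftOp x * b * shiftOp (-x)) := by
        simp only [mul_assoc]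
        rw [← mul_assoc (shiftOp (-x)) (shiftOp x), shiftOp_mul_neg, one_mul]
      rw [this]
      exact mul_mem iha ihb
    | star a _ iha =>
      have : shiftOp x * star a * shiftOp (-x) = star (shiftOp x * a * shiftOp (-x)) := by
        rw [star_mul, star_mul, star_shiftOp, star_shiftOp, neg_neg, mul_assoc]
      rw [this]
      exact star_mem iha
  exact map_mem_closure (f := fun a : BOp L d => shiftOp x * a * shiftOp (-x)) (by fun_prop) a.2 key

/-- The shift `τ_x` of the quasi-local algebra; it maps `A(Ω)` onto `A(Ω + x)`. -/
def shift {L : Type} [AddCommGroup L] [DecidableEq L] {d : ℕ} (x : L)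
    (a : quasiLocal L d) : quasiLocal L d :=
  ⟨shiftOp x * a.1 * shiftOp (-x), shift_mem x a⟩

/-- The operator `a` on the cell `x`, as an element of the quasi-local algebra. -/
def cellOp {L : Type} [DecidableEq L] {d : ℕ} (x : L) (a : Matrix (Fin d) (Fin d) ℂ) :
    quasiLocal L d :=
  regionOp {x} (a.submatrix (fun k => k ⟨x, Finset.mem_singleton_self x⟩)
    (fun k => k ⟨x, Finset.mem_singleton_self x⟩))

/-- A quantum cellular automaton over the lattice `L` with cells of dimension `d`: an automorphism
of the quasi-local algebra, with a finite neighbourhood scheme, local and homogeneous. -/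
structure QCA (L : Type) [AddCommGroup L] [DecidableEq L] (d : ℕ) where
  /-- the automorphism -/
  toEquiv : quasiLocal L d ≃⋆ₐ[ℂ] quasiLocal L d
  /-- the neighbourhood scheme -/
  nbhd : Finset L
  locality : ∀ (Ω : Finset L) (a : quasiLocal L d),
    a.1 ∈ localOps d Ω → (toEquiv a).1 ∈ localOps d (Ω + nbhd)
  homogeneity : ∀ (x : L) (a : quasiLocal L d), toEquiv (shift x a) = shift x (toEquiv a)

/-! ### Finite lattices

For a finite lattice the quasi-local algebra is the full matrix algebra on the configurations. -/

/-- The algebra `A(L)` of a finite lattice. -/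
abbrev MatAlg (L : Type) (d : ℕ) : Type := Matrix (Config L d) (Config L d) ℂ

open Classical in
/-- The matrix `M ⊗ I` on a finite lattice, `M` acting on the cells `g k`, `k : κ`
(for injective `g`). -/
def siteMat {L κ : Type} {d : ℕ} (g : κ → L) (M : Matrix (κ → Fin d) (κ → Fin d) ℂ) :
    MatAlg L d :=
  Matrix.of fun c c' => if ∀ x ∉ Set.range g, c x = c' x then M (c ∘ g) (c' ∘ g) else 0

/-- The algebra `A(Ω)` inside `A(L)`, for a finite lattice `L`. -/
def localMats {L : Type} (d : ℕ) (Ω : Finset L) : Set (MatAlg L d) :=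
  Set.range (siteMat (d := d) (fun x : {x // x ∈ Ω} => (x : L)))

/-- The shift `τ_x` on a finite lattice. -/
def shiftMat {L : Type} [AddCommGroup L] {d : ℕ} (x : L) (A : MatAlg L d) : MatAlg L d :=
  A.submatrix (fun c y => c (y + x)) (fun c y => c (y + x))

/-- The operator `a` on the cell `x` of a finite lattice. -/
def cellMat {L : Type} {d : ℕ} (x : L) (a : Matrix (Fin d) (Fin d) ℂ) : MatAlg L d :=
  siteMat (fun _ : Unit => x) (a.submatrix (fun k => k ()) (fun k => k ()))

/-- A quantum cellular automaton over a finite lattice. -/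
structure FinQCA (L : Type) [AddCommGroup L] [Fintype L] [DecidableEq L] (d : ℕ) where
  /-- the automorphism -/
  toEquiv : MatAlg L d ≃⋆ₐ[ℂ] MatAlg L d
  /-- the neighbourhood scheme -/
  nbhd : Finset L
  locality : ∀ (Ω : Finset L) (A : MatAlg L d),
    A ∈ localMats d Ω → toEquiv A ∈ localMats d (Ω + nbhd)
  homogeneity : ∀ (x : L) (A : MatAlg L d), toEquiv (shiftMat x A) = shiftMat x (toEquiv A)

/-! ### Wrapping -/

/-- The infinite lattice `ℤ^s`. -/
abbrev Lat (s : ℕ) : Type := Fin s → ℤ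

/-- The wrapped lattice `ℤ_m^s`. -/
abbrev Torus (s m : ℕ) : Type := Fin s → ZMod m

/-- The wrapping `ℤ^s → ℤ_m^s`, reduction modulo `m` of each coordinate. -/
def wrap (s m : ℕ) : Lat s →+ Torus s m := (Int.castAddHom (ZMod m)).compLeft (Fin s)

/-- The neighbourhood scheme `𝒩` is regular for the wrapping `φ`: whenever `𝒩_x` and `𝒩_y` meet,
their wrapped images have the same intersection as before wrapping. -/
def IsRegular {L L' : Type} [AddCommGroup L] [AddCommGroup L'] (φ : L →+ L') (𝒩 : Set L) : Prop :=
  ∀ x y : L, ((x +ᵥ 𝒩) ∩ (y +ᵥ 𝒩)).Nonempty →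
    (φ ⁻¹' (φ x +ᵥ φ '' 𝒩) ∩ φ ⁻¹' (φ y +ᵥ φ '' 𝒩)) ∩ ((x +ᵥ 𝒩) ∪ (y +ᵥ 𝒩))
      = (x +ᵥ 𝒩) ∩ (y +ᵥ 𝒩)

/-- `Tw` is the wrapped evolution of `T` on `ℤ_m^s`: the neighbourhood scheme of `T` is regular for
the wrapping, `Tw` has the wrapped neighbourhood scheme, and it has the same transition rule, that
is, if `T` maps the operator `a` on the cell `0` to the matrix `M` on the cells `𝒩`, then `Tw` maps
`a` on the cell `0` to the same matrix `M` on the wrapped cells. -/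
def IsWrapped {s d m : ℕ} [NeZero m] (T : QCA (Lat s) d) (Tw : FinQCA (Torus s m) d) : Prop :=
  IsRegular (wrap s m) (T.nbhd : Set (Lat s)) ∧
  Tw.nbhd = T.nbhd.image (wrap s m) ∧
  ∀ a : Matrix (Fin d) (Fin d) ℂ,
    ∃ M : Matrix ({x // x ∈ T.nbhd} → Fin d) ({x // x ∈ T.nbhd} → Fin d) ℂ,
      T.toEquiv (cellOp 0 a) = regionOp T.nbhd M ∧
      Tw.toEquiv (cellMat 0 a) = siteMat (fun x : {x // x ∈ T.nbhd} => wrap s m x) M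

/-- The neighbourhood scheme `𝒩 + ⋯ + 𝒩` (`n` summands) of the `n`-th power of an automaton with
neighbourhood scheme `𝒩`. -/
def nbhdPow {L : Type} [AddCommGroup L] [DecidableEq L] (𝒩 : Finset L) : ℕ → Finset L
  | 0 => {0}
  | n + 1 => nbhdPow 𝒩 n + 𝒩

/-! ### Tiles and coarse-graining -/

/-- The tile `Λ_y = [0, N-1]^s + N y` of `ℤ^s`. -/
def tile {s : ℕ} (N : ℕ) (y : Lat s) : Set (Lat s) :=
  {z | ∀ t, N * y t ≤ z t ∧ z t < N * y t + N}

/-- The neighbourhood scheme on the lattice of tiles induced by a scheme `𝒩` on cells: the tiles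
that meet the neighbourhood `Λ_0 + 𝒩` of the tile `Λ_0`. -/
def tileNbhd {s : ℕ} (N : ℕ) (𝒩 : Set (Lat s)) : Set (Lat s) :=
  {y | ((tile N 0 + 𝒩) ∩ tile N y).Nonempty}

/-- The neighbourhood of `T^N` is regular over `ℤ_{Nf}^s`, both as a scheme on cells and as a scheme
on tiles, the tiles of `ℤ_{Nf}^s` being labelled by `ℤ_f^s`. -/
def PowRegular {s d : ℕ} (T : QCA (Lat s) d) (N f : ℕ) : Prop :=
  IsRegular (wrap s (N * f)) (nbhdPow T.nbhd N : Set (Lat s)) ∧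
  IsRegular (wrap s f) (tileNbhd N (nbhdPow T.nbhd N : Set (Lat s)))

/-- Configurations of the tile `Λ_0 = [0, N-1]^s`. -/
abbrev TileConfig (s N d : ℕ) : Type := (Fin s → Fin N) → Fin d

/-- The content of the tile `Λ_x` of `ℤ_{Nf}^s` in a configuration, translated to `Λ_0`: the cell
`k` of `Λ_0` corresponds to the cell `N x + k`. -/
def tileContent {s N f d : ℕ} (c : Config (Torus s (N * f)) d) (x : Torus s f) :
    TileConfig s N d :=
  fun k => c fun t => ((N * (x t).val + (k t : ℕ) : ℕ) : ZMod (N * f))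

/-- The matrix `Π = ⊗_x Π_x` on `ℤ_{Nf}^s`, where `Π_x` is the translate of `Π₀` to `Λ_x`. -/
def bigProj {s N d : ℕ} (f : ℕ) [NeZero f]
    (Proj₀ : Matrix (TileConfig s N d) (TileConfig s N d) ℂ) : MatAlg (Torus s (N * f)) d :=
  Matrix.of fun c c' => ∏ x : Torus s f, Proj₀ (tileContent c x) (tileContent c' x)

/-- The matrix `J = ⊗_x J_{Λ_x}`, from the operators on `ℤ_{Nf}^s` to those on `ℤ_f^s`. -/
def bigJ {s N d d' : ℕ} (f : ℕ) [NeZero f] (J₀ : Matrix (Fin d') (TileConfig s N d) ℂ) :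
    Matrix (Config (Torus s f) d') (Config (Torus s (N * f)) d) ℂ :=
  Matrix.of fun k c => ∏ x : Torus s f, J₀ (k x) (tileContent c x)

/-- `J₀ = ∑ k, |k⟩⟨ψ_k|` for an orthonormal basis `ψ_0, …, ψ_{d'-1}` of the range of `Π₀`. -/
def IsCoarseIsometry {s N d d' : ℕ} (Proj₀ : Matrix (TileConfig s N d) (TileConfig s N d) ℂ)
    (J₀ : Matrix (Fin d') (TileConfig s N d) ℂ) : Prop :=
  J₀ᴴ * J₀ = Proj₀ ∧ J₀ * J₀ᴴ = 1

/-- The embedding `𝒱(A) = J† A J` of `A(ℤ_f^s)` in `A(ℤ_{Nf}^s)`. -/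
def embedV {s N d d' : ℕ} (f : ℕ) [NeZero N] [NeZero f]
    (J₀ : Matrix (Fin d') (TileConfig s N d) ℂ) (A : MatAlg (Torus s f) d') :
    MatAlg (Torus s (N * f)) d :=
  (bigJ f J₀)ᴴ * A * bigJ f J₀

/-- `S` is a size-`N` renormalisation of `T` through the coarse-graining given by `J₀`: on each
wrapped lattice `ℤ_{Nf}^s` over which the neighbourhood of `T^N` is regular,
`T_w^N ∘ 𝒱 = 𝒱 ∘ S_w`. -/
def IsRenormalisation {s N d d' : ℕ} [NeZero N] (T : QCA (Lat s) d) (S : QCA (Lat s) d')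
    (J₀ : Matrix (Fin d') (TileConfig s N d) ℂ) : Prop :=
  ∀ (f : ℕ) [NeZero f], PowRegular T N f →
    ∃ (Tw : FinQCA (Torus s (N * f)) d) (Sw : FinQCA (Torus s f) d'),
      IsWrapped T Tw ∧ IsWrapped S Sw ∧
      ∀ A : MatAlg (Torus s f) d', Tw.toEquiv^[N] (embedV f J₀ A) = embedV f J₀ (Sw.toEquiv A)

/-- There is a wrapped lattice `ℤ_{Nf}^s` over which the neighbourhood of `T^N` is regular and on
which the unitary `U` with `T_w^N(A) = U† A U` commutes with `Π = ⊗_x Π_x`. -/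
def CommutesOnSomeTorus {s N d : ℕ} [NeZero N] (T : QCA (Lat s) d)
    (Proj₀ : Matrix (TileConfig s N d) (TileConfig s N d) ℂ) : Prop :=
  ∃ (f : ℕ) (_ : NeZero f), PowRegular T N f ∧
    ∃ Tw : FinQCA (Torus s (N * f)) d, IsWrapped T Tw ∧
    ∃ U ∈ Matrix.unitaryGroup (Config (Torus s (N * f)) d) ℂ,
      (∀ A : MatAlg (Torus s (N * f)) d, Tw.toEquiv^[N] A = Uᴴ * A * U) ∧
      U * bigProj f Proj₀ = bigProj f Proj₀ * U

end QCAutomata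

end

open scoped Pointwise Matrix ENNReal

set_option linter.unusedSectionVars false

noncomputable section

namespace QCAutomata

/-! ### Tensor products of matrices over finite sets of cells -/

section Emb

variable {α κ K L ι : Type}

/-! Group the cells into tiles. Then `N` steps of `T` become one step of an automaton on tiles
(`coarse`), whose transition rule is the same on all tori with a regular neighbourhood
(`exists_coarse_rule`). Write p = J₀†J₀ for the projection of one tile and Π for the product of its
copies.

If `S` renormalises `T`, apply the intertwining relation to the identity on some regular torus: 𝒱(1)
= Π and S_w(1) = 1, so T_w^N fixes Π, which means that U commutes with Π.

Conversely, let Π be fixed on one regular torus. Since p_x Π = Π, also T_w^N(p_x) Π = Π. The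
operator T_w^N(p_x) acts on finitely many tiles, and off these both sides are the same nonzero
product of entries of p. The condition therefore concerns the rule alone (`emb_mul_tens_eq_iff`) and
passes to every regular torus. Multiplying over all tiles there gives T_w^N(Π) Π = Π, that is, Π
lies below its image; the two have the same trace, so they are equal (`fixes_tens_of_cells`). An
automorphism fixing Π restricts to the corner cut out by Π, which 𝒱 identifies with the algebra of
the coarse torus (`exists_compressed_equiv`). Its rule is again independent of the torus
(`compressed_rule`).

It remains to lift this rule from one torus to ℤ^s (`exists_unwrapped`). For a finite scheme,
regularity means that wrapping kills no nonzero sum of two differences (`IsRegular.diffInj`,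
`DiffInj.isRegular`). Hence the images of distinct cells commute on ℤ^s because they do on the
torus, and commuting images extend to an isometric homomorphism of the quasi-local algebra
(`exists_quasiLocal_hom`). It is onto because on the torus the preimage of an operator on the cell x
lives on x − P, P being the scheme, and this finite identity lifts as well (`cellOp_mem_range`). -/

open Classical in
/-- The matrix `M ⊗ I`, `M` acting on the cells `g k`, with an arbitrary type `α` of cell states. -/
def emb (g : κ → L) (M : Matrix (κ → α) (κ → α) ℂ) : Matrix (L → α) (L → α) ℂ :=
  Matrix.of fun c c' => if ∀ x ∉ Set.range g, c x = c' x then M (c ∘ g) (c' ∘ g) else 0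

theorem siteMat_eq_emb {d : ℕ} (g : κ → L) (M : Matrix (κ → Fin d) (κ → Fin d) ℂ) :
    siteMat g M = emb g M := rfl

theorem emb_apply_of {g : κ → L} {M : Matrix (κ → α) (κ → α) ℂ} {c c' : L → α}
    (h : ∀ x ∉ Set.range g, c x = c' x) : emb g M c c' = M (c ∘ g) (c' ∘ g) := if_pos h

theorem emb_apply_of_not {g : κ → L} {M : Matrix (κ → α) (κ → α) ℂ} {c c' : L → α}
    (h : ¬ ∀ x ∉ Set.range g, c x = c' x) : emb g M c c' = 0 := if_neg h

theorem extend_notMem_range (g : κ → L) (b : κ → α) (c : L → α) {x : L} (hx : x ∉ Set.range g) :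
    Function.extend g b c x = c x :=
  Function.extend_apply' _ _ _ fun ⟨k, hk⟩ => hx ⟨k, hk⟩

theorem extend_comp_of_eq {g : κ → L} (hg : g.Injective) {c c' : L → α}
    (h : ∀ x ∉ Set.range g, c x = c' x) : Function.extend g (c' ∘ g) c = c' := by
  funext x
  by_cases hx : x ∈ Set.range g
  · obtain ⟨k, rfl⟩ := hx
    rw [hg.extend_apply, Function.comp_apply]
  · rw [extend_notMem_range _ _ _ hx, h x hx]

theorem extend_extend {g : κ → L} (hg : g.Injective) (b b' : κ → α) (c : L → α) :
    Function.extend g b (Function.extend g b' c) = Function.extend g b c := by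
  funext x
  by_cases hx : x ∈ Set.range g
  · obtain ⟨k, rfl⟩ := hx
    rw [hg.extend_apply, hg.extend_apply]
  · simp only [extend_notMem_range _ _ _ hx]

section Fin

variable [Fintype α] [DecidableEq α] [Fintype κ] [DecidableEq κ] [Fintype L] [DecidableEq L]
  [Fintype K] [DecidableEq K]

theorem emb_mul_apply {g : κ → L} (hg : g.Injective) (M : Matrix (κ → α) (κ → α) ℂ)
    (A : Matrix (L → α) ι ℂ) (c : L → α) (c' : ι) :
    (emb g M * A) c c' = ∑ b : κ → α, M (c ∘ g) b * A (Function.extend g b c) c' := by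
  rw [Matrix.mul_apply]
  refine (Finset.sum_of_injOn (fun b => Function.extend g b c) ?_ (by simp) ?_ ?_).symm
  · intro b _ b' _ h
    simpa [Function.extend_comp hg] using congrArg (· ∘ g) h
  · intro c'' _ hc''
    rw [emb_apply_of_not, zero_mul]
    exact fun h => hc'' ⟨c'' ∘ g, by simp, extend_comp_of_eq hg h⟩
  · intro b _
    rw [emb_apply_of fun x hx => (extend_notMem_range g b c hx).symm, Function.extend_comp hg]

theorem mul_emb_apply {g : κ → L} (hg : g.Injective) (M : Matrix (κ → α) (κ → α) ℂ)
    (A : Matrix ι (L → α) ℂ) (c : ι) (c' : L → α) :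
    (A * emb g M) c c' = ∑ b : κ → α, A c (Function.extend g b c') * M b (c' ∘ g) := by
  rw [Matrix.mul_apply]
  refine (Finset.sum_of_injOn (fun b => Function.extend g b c') ?_ (by simp) ?_ ?_).symm
  · intro b _ b' _ h
    simpa [Function.extend_comp hg] using congrArg (· ∘ g) h
  · intro c'' _ hc''
    rw [emb_apply_of_not, mul_zero]
    exact fun h => hc'' ⟨c'' ∘ g, by simp, extend_comp_of_eq hg fun x hx => (h x hx).symm⟩
  · intro b _
    rw [emb_apply_of fun x hx => extend_notMem_range g b c' hx, Function.extend_comp hg]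

theorem emb_mul {g : κ → L} (hg : g.Injective) (M M' : Matrix (κ → α) (κ → α) ℂ) :
    emb g (M * M') = emb g M * emb g M' := by
  ext c c'
  rw [emb_mul_apply hg]
  by_cases h : ∀ x ∉ Set.range g, c x = c' x
  · rw [emb_apply_of h, Matrix.mul_apply]
    refine Finset.sum_congr rfl fun b _ => ?_
    rw [emb_apply_of fun x hx => (extend_notMem_range g b c hx).trans (h x hx),
      Function.extend_comp hg]
  · rw [emb_apply_of_not h, Finset.sum_eq_zero]
    intro b _
    rw [emb_apply_of_not, mul_zero]
    exact fun h' => h fun x hx => (extend_notMem_range g b c hx).symm.trans (h' x hx)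

theorem emb_one {g : κ → L} : emb g (1 : Matrix (κ → α) (κ → α) ℂ) = 1 := by
  ext c c'
  by_cases h : c = c'
  · subst h
    rw [emb_apply_of fun _ _ => rfl, Matrix.one_apply_eq, Matrix.one_apply_eq]
  · rw [Matrix.one_apply_ne h]
    by_cases h' : ∀ x ∉ Set.range g, c x = c' x
    · rw [emb_apply_of h', Matrix.one_apply_ne]
      intro h''
      refine h (funext fun x => ?_)
      by_cases hx : x ∈ Set.range g
      · obtain ⟨k, rfl⟩ := hx
        exact congrFun h'' k
      · exact h' x hx
    · exact emb_apply_of_not h'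

theorem emb_add (g : κ → L) (M M' : Matrix (κ → α) (κ → α) ℂ) :
    emb g (M + M') = emb g M + emb g M' := by
  ext c c'
  by_cases h : ∀ x ∉ Set.range g, c x = c' x
  · simp [emb_apply_of h]
  · simp [emb_apply_of_not h]

theorem emb_smul (g : κ → L) (z : ℂ) (M : Matrix (κ → α) (κ → α) ℂ) :
    emb g (z • M) = z • emb g M := by
  ext c c'
  by_cases h : ∀ x ∉ Set.range g, c x = c' x
  · simp [emb_apply_of h]
  · simp [emb_apply_of_not h]

theorem emb_star (g : κ → L) (M : Matrix (κ → α) (κ → α) ℂ) :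
    emb g (star M) = star (emb g M) := by
  ext c c'
  rw [Matrix.star_apply]
  by_cases h : ∀ x ∉ Set.range g, c x = c' x
  · rw [emb_apply_of h, emb_apply_of fun x hx => (h x hx).symm, Matrix.star_apply]
  · rw [emb_apply_of_not h, emb_apply_of_not fun h' => h fun x hx => (h' x hx).symm, star_zero]

/-- `M ↦ M ⊗ I` as a homomorphism. -/
def embHom {g : κ → L} (hg : g.Injective) :
    Matrix (κ → α) (κ → α) ℂ →⋆ₐ[ℂ] Matrix (L → α) (L → α) ℂ where
  toFun := emb g
  map_one' := emb_one
  map_mul' := emb_mul hg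
  map_zero' := by simpa using emb_smul g 0 (0 : Matrix (κ → α) (κ → α) ℂ)
  map_add' := emb_add g
  commutes' z := by
    rw [Algebra.algebraMap_eq_smul_one, emb_smul, emb_one, Algebra.algebraMap_eq_smul_one]
  map_star' := emb_star g

theorem embHom_apply {g : κ → L} (hg : g.Injective) (M : Matrix (κ → α) (κ → α) ℂ) :
    embHom hg M = emb g M := rfl

end Fin

theorem emb_comp {h : K → L} (hh : h.Injective) (g : κ → K) (M : Matrix (κ → α) (κ → α) ℂ) :
    emb (h ∘ g) M = emb h (emb g M) := by
  ext c c'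
  by_cases h1 : ∀ x ∉ Set.range h, c x = c' x
  · rw [emb_apply_of h1]
    by_cases h2 : ∀ y ∉ Set.range g, (c ∘ h) y = (c' ∘ h) y
    · rw [emb_apply_of h2, emb_apply_of]
      · rfl
      · intro x hx
        by_cases hx' : x ∈ Set.range h
        · obtain ⟨y, rfl⟩ := hx'
          exact h2 y fun ⟨k, hk⟩ => hx ⟨k, congrArg h hk⟩
        · exact h1 x hx'
    · rw [emb_apply_of_not h2, emb_apply_of_not]
      refine fun h3 => h2 fun y hy => h3 (h y) ?_
      rintro ⟨k, hk⟩
      exact hy ⟨k, hh hk⟩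
  · rw [emb_apply_of_not h1, emb_apply_of_not]
    refine fun h3 => h1 fun x hx => h3 x ?_
    rintro ⟨k, rfl⟩
    exact hx ⟨g k, rfl⟩

theorem emb_injective [Nonempty α] {g : κ → L} (hg : g.Injective) :
    Function.Injective (emb (α := α) g) := by
  intro M M' h
  ext a b
  let c₀ : L → α := fun _ => Classical.arbitrary α
  have := congrFun (congrFun h (Function.extend g a c₀)) (Function.extend g b c₀)
  have hx : ∀ x ∉ Set.range g, Function.extend g a c₀ x = Function.extend g b c₀ x := fun x hx => by
    rw [extend_notMem_range _ _ _ hx, extend_notMem_range _ _ _ hx]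
  rwa [emb_apply_of hx, emb_apply_of hx, Function.extend_comp hg, Function.extend_comp hg] at this

theorem emb_shift [AddCommGroup L] (x : L) (g : κ → L) (M : Matrix (κ → α) (κ → α) ℂ) :
    (emb g M).submatrix (fun c y => c (y + x)) (fun c y => c (y + x))
      = emb (fun k => g k + x) M := by
  ext c c'
  rw [Matrix.submatrix_apply]
  by_cases h : ∀ y ∉ Set.range g, c (y + x) = c' (y + x)
  · rw [emb_apply_of h, emb_apply_of]
    · rfl
    · intro z hz
      have := h (z - x) fun ⟨k, hk⟩ => hz ⟨k, by simp [hk]⟩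
      simpa using this
  · rw [emb_apply_of_not h, emb_apply_of_not]
    refine fun h' => h fun y hy => h' _ ?_
    rintro ⟨k, hk⟩
    exact hy ⟨k, add_right_cancel hk⟩

/-- The operator `a` on the cell `x`. -/
def cell (x : L) (a : Matrix α α ℂ) : Matrix (L → α) (L → α) ℂ :=
  emb (fun _ : Unit => x) (a.submatrix (fun k => k ()) (fun k => k ()))

theorem cellMat_eq_cell {d : ℕ} (x : L) (a : Matrix (Fin d) (Fin d) ℂ) :
    cellMat x a = cell x a := rfl

theorem emb_cell {g : K → L} (hg : g.Injective) (k : K) (a : Matrix α α ℂ) :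
    emb g (cell k a) = cell (g k) a := (emb_comp hg (fun _ : Unit => k) _).symm

/-- The tensor product of the matrices `a x`, over all cells `x`. -/
def tens {β : Type} [Fintype L] (a : L → Matrix β α ℂ) : Matrix (L → β) (L → α) ℂ :=
  Matrix.of fun b c => ∏ x, a x (b x) (c x)

/-! ### Elementary tensors, one-cell operators and commutants. -/

section Tens

variable {β γ : Type} [Fintype α] [DecidableEq α] [Fintype κ] [DecidableEq κ] [Fintype L]
  [DecidableEq L] [Fintype K] [DecidableEq K]

theorem tens_apply (a : L → Matrix β α ℂ) (b : L → β) (c : L → α) :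
    tens a b c = ∏ x, a x (b x) (c x) := rfl

theorem tens_mul (a : L → Matrix β α ℂ) (b : L → Matrix α γ ℂ) :
    tens a * tens b = tens (fun x => a x * b x) := by
  ext u v
  simp only [Matrix.mul_apply, tens_apply, ← Finset.prod_mul_distrib]
  rw [Finset.prod_univ_sum, Fintype.piFinset_univ]

theorem tens_conjTranspose (a : L → Matrix β α ℂ) : (tens a)ᴴ = tens (fun x => (a x)ᴴ) := by
  ext u v
  simp [tens_apply, Matrix.conjTranspose_apply]

theorem tens_one : tens (fun _ : L => (1 : Matrix α α ℂ)) = 1 := by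
  ext u v
  rw [tens_apply]
  by_cases h : u = v
  · subst h; simp
  · rw [Matrix.one_apply_ne h]
    obtain ⟨x, hx⟩ := Function.ne_iff.1 h
    exact Finset.prod_eq_zero (Finset.mem_univ x) (Matrix.one_apply_ne hx)

theorem emb_tens {g : κ → L} (hg : g.Injective) (a : κ → Matrix α α ℂ) :
    emb g (tens a) = tens (Function.extend g a 1) := by
  ext c c'
  rw [tens_apply]
  by_cases h : ∀ x ∉ Set.range g, c x = c' x
  · rw [emb_apply_of h, tens_apply]
    refine Finset.prod_of_injOn g hg.injOn (by simp) (fun x _ hx => ?_) fun k _ => ?_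
    · rw [extend_notMem_range _ _ _ (by simpa using hx), h x (by simpa using hx)]
      simp
    · rw [hg.extend_apply]; rfl
  · rw [emb_apply_of_not h]
    push Not at h
    obtain ⟨x, hx, hne⟩ := h
    refine (Finset.prod_eq_zero (Finset.mem_univ x) ?_).symm
    rw [extend_notMem_range _ _ _ hx]
    exact Matrix.one_apply_ne hne

theorem cell_eq_tens (x : L) (a : Matrix α α ℂ) : cell x a = tens (Function.update 1 x a) := by
  have h : a.submatrix (fun k : Unit → α => k ()) (fun k => k ()) = tens fun _ => a := by
    ext u v
    simp [tens_apply]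
  rw [cell, h, emb_tens (fun _ _ _ => rfl)]
  congr 1
  funext y
  by_cases hy : y = x
  · subst hy
    rw [Function.update_self]
    exact Function.Injective.extend_apply (f := fun _ : Unit => y) (fun _ _ _ => rfl) _ _ ()
  · rw [Function.update_of_ne hy, extend_notMem_range]
    rintro ⟨_, rfl⟩
    exact hy rfl

theorem cell_mul_tens (x : L) (a : Matrix α α ℂ) (b : L → Matrix α β ℂ) :
    cell x a * tens b = tens (Function.update b x (a * b x)) := by
  rw [cell_eq_tens, tens_mul]
  congr 1
  funext y
  by_cases hy : y = x
  · subst hy; simp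
  · simp [Function.update_of_ne hy]

theorem single_eq_tens (c c' : L → α) :
    Matrix.single c c' (1 : ℂ) = tens fun x => Matrix.single (c x) (c' x) 1 := by
  ext u v
  rw [tens_apply, Matrix.single_apply]
  split_ifs with h
  · obtain ⟨rfl, rfl⟩ := h
    simp
  · by_cases h1 : c = u
    · have h2 : c' ≠ v := fun h2 => h ⟨h1, h2⟩
      obtain ⟨x, hx⟩ := Function.ne_iff.1 h2
      exact (Finset.prod_eq_zero (Finset.mem_univ x) (by simp [hx])).symm
    · obtain ⟨x, hx⟩ := Function.ne_iff.1 h1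
      exact (Finset.prod_eq_zero (Finset.mem_univ x) (by simp [hx])).symm

/-- Matrices are linear combinations of elementary tensors. -/
@[elab_as_elim]
theorem tens_induction {P : Matrix (L → α) (L → α) ℂ → Prop} (htens : ∀ a, P (tens a))
    (hadd : ∀ A B, P A → P B → P (A + B)) (hsmul : ∀ (z : ℂ) A, P A → P (z • A))
    (A : Matrix (L → α) (L → α) ℂ) : P A := by
  have h0 : P 0 := by simpa using hsmul 0 _ (htens 1)
  rw [Matrix.matrix_eq_sum_single A]
  refine Finset.sum_induction _ P hadd h0 fun c _ => Finset.sum_induction _ P hadd h0 fun c' _ => ?_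
  have : Matrix.single c c' (A c c') = A c c' • Matrix.single c c' (1 : ℂ) := by simp
  rw [this, single_eq_tens]
  exact hsmul _ _ (htens _)

theorem cell_one (x : L) : cell x (1 : Matrix α α ℂ) = 1 := by
  rw [cell_eq_tens, ← Pi.one_apply (M := fun _ : L => Matrix α α ℂ) x, Function.update_eq_self,
    ← tens_one]
  rfl

/-- The algebra of all matrices is generated by the operators on single cells. -/
@[elab_as_elim]
theorem cell_induction {P : Matrix (L → α) (L → α) ℂ → Prop} (hone : P 1)
    (hcell : ∀ x a, P (cell x a)) (hadd : ∀ A B, P A → P B → P (A + B))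
    (hmul : ∀ A B, P A → P B → P (A * B)) (hsmul : ∀ (z : ℂ) A, P A → P (z • A))
    (A : Matrix (L → α) (L → α) ℂ) : P A := by
  refine tens_induction (fun a => ?_) hadd hsmul A
  -- An elementary tensor is the product of its one-cell factors, collected one cell at a time.
  have key : ∀ Ω : Finset L, P (tens fun x => if x ∈ Ω then a x else 1) := by
    intro Ω
    induction Ω using Finset.induction_on with
    | empty => simpa [tens_one] using hone
    | insert x Ω hx ih =>
      convert hmul _ _ (hcell x (a x)) ih using 1
      rw [cell_mul_tens]
      congr 1
      funext y
      by_cases hy : y = x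
      · subst hy; simp [hx]
      · simp [hy]
  simpa using key Finset.univ

theorem emb_commute_of_disjoint {g : κ → L} {h : K → L} (hg : g.Injective) (hh : h.Injective)
    (hd : ∀ k l, g k ≠ h l) (M : Matrix (κ → α) (κ → α) ℂ) (M' : Matrix (K → α) (K → α) ℂ) :
    Commute (emb g M) (emb h M') := by
  induction M using tens_induction with
  | htens a =>
    induction M' using tens_induction with
    | htens b =>
      rw [Commute, SemiconjBy, emb_tens hg, emb_tens hh, tens_mul, tens_mul]
      congr 1
      funext x
      by_cases hx : x ∈ Set.range g
      · obtain ⟨k, rfl⟩ := hx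
        rw [extend_notMem_range h b 1 (fun ⟨l, hl⟩ => hd k l hl.symm)]
        simp
      · rw [extend_notMem_range g a 1 hx]
        simp
    | hadd A B hA hB => rw [emb_add]; exact hA.add_right hB
    | hsmul z A hA => rw [emb_smul]; exact hA.smul_right z
  | hadd A B hA hB => rw [emb_add]; exact hA.add_left hB
  | hsmul z A hA => rw [emb_smul]; exact hA.smul_left z

theorem cell_commute {x y : L} (h : x ≠ y) (a b : Matrix α α ℂ) :
    Commute (cell x a) (cell y b) :=
  emb_commute_of_disjoint (fun _ _ _ => rfl) (fun _ _ _ => rfl) (fun _ _ => h) _ _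

/-- The operators on the cell `x` as a homomorphism. -/
def cellHom (x : L) : Matrix α α ℂ →⋆ₐ[ℂ] Matrix (L → α) (L → α) ℂ where
  toFun := cell x
  map_one' := cell_one x
  map_mul' a b := by
    rw [cell_eq_tens x b, cell_mul_tens, cell_eq_tens]
    simp
  map_zero' := by
    rw [cell_eq_tens]
    ext u v
    exact Finset.prod_eq_zero (Finset.mem_univ x) (by simp)
  map_add' a b := by
    rw [cell, cell, cell, ← emb_add]; rfl
  commutes' z := by
    rw [Algebra.algebraMap_eq_smul_one, Algebra.algebraMap_eq_smul_one, ← cell_one x, cell, cell,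
      ← emb_smul]; rfl
  map_star' a := by
    rw [cell, cell, ← emb_star]; rfl

/-- A matrix that commutes with the operators on all cells outside of the range of `g` acts on the
cells in the range of `g` only. -/
theorem exists_emb_of_commute [Nonempty α] {g : κ → L} (hg : g.Injective)
    (X : Matrix (L → α) (L → α) ℂ) (hX : ∀ y ∉ Set.range g, ∀ a, Commute X (cell y a)) :
    ∃ M, X = emb g M := by
  classical
  let h : {y // y ∉ Set.range g} → L := Subtype.val
  have hh : h.Injective := Subtype.val_injective
  have hr : ∀ x, x ∉ Set.range g ↔ x ∈ Set.range h := by simp [h]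
  -- One-cell operators generate, so X commutes with the whole algebra of the complementary cells.
  have hcomm : ∀ M', Commute X (emb h M') := by
    intro M'
    induction M' using cell_induction with
    | hone => rw [emb_one]; exact Commute.one_right _
    | hcell y a => rw [emb_cell hh]; exact hX y y.2 a
    | hadd A B hA hB => rw [emb_add]; exact hA.add_right hB
    | hmul A B hA hB => rw [emb_mul hh]; exact hA.mul_right hB
    | hsmul z A hA => rw [emb_smul]; exact hA.smul_right z
  -- Entry (c, c') of the commutation of X with the matrix unit |u⟩⟨v| on the complement. For u = v
  -- it makes X block diagonal in the outer configuration; for v the background `c₀ ∘ h` it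
  -- identifies every block with the background block.
  have key : ∀ (u v) (c c' : L → α), (if c' ∘ h = v then X c (Function.extend h u c') else 0)
      = if c ∘ h = u then X (Function.extend h v c) c' else 0 := by
    intro u v c c'
    have := congrFun (congrFun (hcomm (Matrix.single u v 1)) c) c'
    rw [emb_mul_apply hh, mul_emb_apply hh] at this
    simpa [Matrix.single_apply, ite_and, eq_comm] using this
  let c₀ : L → α := fun _ => Classical.arbitrary α
  refine ⟨Matrix.of fun a b => X (Function.extend g a c₀) (Function.extend g b c₀), ?_⟩
  ext c c'
  by_cases hc : ∀ x ∉ Set.range g, c x = c' x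
  · rw [emb_apply_of hc, Matrix.of_apply]
    have h1 := key (c ∘ h) (c₀ ∘ h) c (Function.extend h (c₀ ∘ h) c')
    rw [Function.extend_comp hh, if_pos rfl, if_pos rfl, extend_extend hh] at h1
    have e : ∀ w : L → α, Function.extend h (c₀ ∘ h) w = Function.extend g (w ∘ g) c₀ := by
      intro w
      funext x
      by_cases hx : x ∈ Set.range g
      · rw [extend_notMem_range h _ _ (fun hx' => (hr x).2 hx' hx)]
        obtain ⟨k, rfl⟩ := hx
        rw [hg.extend_apply]; rfl
      · rw [extend_notMem_range g _ _ hx]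
        obtain ⟨y, rfl⟩ := (hr x).1 hx
        rw [hh.extend_apply]; rfl
    rw [← e, ← e, ← h1]
    have e2 : c ∘ h = c' ∘ h := funext fun y => hc y.1 y.2
    rw [e2, extend_comp_of_eq hh fun _ _ => rfl]
  · rw [emb_apply_of_not hc]
    have h1 := key (c ∘ h) (c ∘ h) c c'
    rw [if_pos rfl, extend_comp_of_eq hh fun _ _ => rfl, if_neg] at h1
    · exact h1.symm
    · exact fun h2 => hc fun x hx => (congrFun h2 ⟨x, hx⟩).symm

end Tens

end Emb

/-! ### Local operators on a possibly infinite lattice -/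

section SiteOp

variable {L κ K : Type} [Fintype κ] [DecidableEq κ] [Fintype K] [DecidableEq K] {d : ℕ}

theorem siteOp_mul (g : κ ↪ L) (M M' : Matrix (κ → Fin d) (κ → Fin d) ℂ) :
    siteOp g (M * M') = siteOp g M * siteOp g M' := by
  ext ψ c
  change _ = siteOp g M (siteOp g M' ψ) c
  simp only [siteOp_apply, Matrix.mul_apply, Finset.sum_mul, Finset.mul_sum,
    Function.extend_comp g.injective, extend_extend g.injective]
  rw [Finset.sum_comm]
  simp only [mul_assoc]

theorem siteOp_one (g : κ ↪ L) : siteOp g (1 : Matrix (κ → Fin d) (κ → Fin d) ℂ) = 1 := by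
  ext ψ c
  rw [siteOp_apply, Finset.sum_eq_single (c ∘ g)]
  · rw [Matrix.one_apply_eq, one_mul, extend_comp_of_eq g.injective fun _ _ => rfl]
    rfl
  · intro b _ hb
    rw [Matrix.one_apply_ne hb.symm, zero_mul]
  · simp

theorem siteOp_add (g : κ ↪ L) (M M' : Matrix (κ → Fin d) (κ → Fin d) ℂ) :
    siteOp g (M + M') = siteOp g M + siteOp g M' := by
  simp only [siteOp, Matrix.add_apply, add_smul, Finset.sum_add_distrib]

theorem siteOp_smul (g : κ ↪ L) (z : ℂ) (M : Matrix (κ → Fin d) (κ → Fin d) ℂ) :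
    siteOp g (z • M) = z • siteOp g M := by
  simp only [siteOp, Matrix.smul_apply, smul_eq_mul, mul_smul, Finset.smul_sum]

/-- These operators are |a⟩⟨b| ⊗ I and |b⟩⟨a| ⊗ I. Both inner products are sums over configurations
with a prescribed pattern on the sites, and overwriting one pattern by the other matches the sums
term by term. -/
theorem star_pull_extend (g : κ ↪ L) (a b : κ → Fin d) :
    star (pull {c : Config L d | c ∘ g = a} (fun c => Function.extend g b c) (extend_injOn g a b))
      = pull {c : Config L d | c ∘ g = b} (fun c => Function.extend g a c)
        (extend_injOn g b a) := by
  rw [ContinuousLinearMap.star_eq_adjoint, eq_comm, ContinuousLinearMap.eq_adjoint_iff]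
  intro ψ χ
  rw [lp.inner_eq_tsum, lp.inner_eq_tsum]
  have h1 : ∀ c, inner ℂ (pull {c : Config L d | c ∘ g = b} (fun c => Function.extend g a c)
        (extend_injOn g b a) ψ c) (χ c) = {c : Config L d | c ∘ g = b}.indicator
        (fun c => inner ℂ (ψ (Function.extend g a c)) (χ c)) c := by
    intro c
    rw [pull_apply]
    by_cases hc : c ∈ {c : Config L d | c ∘ g = b}
    · rw [Set.indicator_of_mem hc, Set.indicator_of_mem hc]
    · rw [Set.indicator_of_notMem hc, Set.indicator_of_notMem hc, inner_zero_left]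
  have h2 : ∀ c, inner ℂ (ψ c) (pull {c : Config L d | c ∘ g = a} (fun c => Function.extend g b c)
        (extend_injOn g a b) χ c) = {c : Config L d | c ∘ g = a}.indicator
        (fun c => inner ℂ (ψ c) (χ (Function.extend g b c))) c := by
    intro c
    rw [pull_apply]
    by_cases hc : c ∈ {c : Config L d | c ∘ g = a}
    · rw [Set.indicator_of_mem hc, Set.indicator_of_mem hc]
    · rw [Set.indicator_of_notMem hc, Set.indicator_of_notMem hc, inner_zero_right]
  simp only [h1, h2]
  rw [← tsum_subtype, ← tsum_subtype]
  let e : {c : Config L d | c ∘ g = b} ≃ {c : Config L d | c ∘ g = a} :=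
    { toFun := fun c => ⟨Function.extend g a c.1, Function.extend_comp g.injective _ _⟩
      invFun := fun c => ⟨Function.extend g b c.1, Function.extend_comp g.injective _ _⟩
      left_inv := fun c => Subtype.ext <| by
        change Function.extend g b (Function.extend g a c.1) = c.1
        rw [extend_extend g.injective]
        exact (congrArg (fun u => Function.extend g u c.1) c.2.symm).trans
          (extend_comp_of_eq g.injective fun _ _ => rfl)
      right_inv := fun c => Subtype.ext <| by
        change Function.extend g a (Function.extend g b c.1) = c.1
        rw [extend_extend g.injective]
        exact (congrArg (fun u => Function.extend g u c.1) c.2.symm).trans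
          (extend_comp_of_eq g.injective fun _ _ => rfl) }
  rw [← Equiv.tsum_eq e]
  refine tsum_congr fun c => ?_
  change _ = inner ℂ (ψ (Function.extend g a c.1)) (χ (Function.extend g b (Function.extend g a c.1)))
  have hc : Function.extend g b (Function.extend g a c.1) = c.1 := congrArg Subtype.val (e.left_inv c)
  rw [hc]

theorem siteOp_star (g : κ ↪ L) (M : Matrix (κ → Fin d) (κ → Fin d) ℂ) :
    siteOp g (star M) = star (siteOp g M) := by
  simp only [siteOp, star_sum, star_smul, star_pull_extend, Matrix.star_apply]
  rw [Finset.sum_comm]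

/-- `M ↦ M ⊗ I` as a homomorphism to the bounded operators. -/
def siteHom (g : κ ↪ L) : Matrix (κ → Fin d) (κ → Fin d) ℂ →⋆ₐ[ℂ] BOp L d where
  toFun := siteOp g
  map_one' := siteOp_one g
  map_mul' := siteOp_mul g
  map_zero' := by simpa using siteOp_smul g 0 (0 : Matrix (κ → Fin d) (κ → Fin d) ℂ)
  map_add' := siteOp_add g
  commutes' z := by
    rw [Algebra.algebraMap_eq_smul_one, siteOp_smul, siteOp_one, Algebra.algebraMap_eq_smul_one]
  map_star' := siteOp_star g

/-- Only configurations of `K` that agree with the given one off the range of `g` contribute on the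
right. This transports identities between matrices on a finite region to operators on the infinite
lattice. -/
theorem siteOp_trans (g : κ ↪ K) (h : K ↪ L) (M : Matrix (κ → Fin d) (κ → Fin d) ℂ) :
    siteOp (g.trans h) M = siteOp h (emb g M) := by
  ext ψ c
  rw [siteOp_apply, siteOp_apply]
  refine Finset.sum_of_injOn (fun b => Function.extend g b (c ∘ h)) ?_ (by simp) ?_ ?_
  · intro b _ b' _ hb
    simpa [Function.extend_comp g.injective] using congrArg (· ∘ g) hb
  · intro b _ hb
    rw [emb_apply_of_not, zero_mul]
    exact fun h' => hb ⟨b ∘ g, by simp, extend_comp_of_eq g.injective h'⟩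
  · intro b _
    rw [emb_apply_of fun x hx => (extend_notMem_range g b _ hx).symm,
      Function.extend_comp g.injective]
    refine congrArg₂ (· * ·) rfl (congrArg ψ ?_)
    funext x
    by_cases hx : x ∈ Set.range h
    · obtain ⟨y, rfl⟩ := hx
      rw [h.injective.extend_apply]
      by_cases hy : y ∈ Set.range g
      · obtain ⟨k, rfl⟩ := hy
        rw [g.injective.extend_apply]
        exact (g.trans h).injective.extend_apply b c k
      · rw [extend_notMem_range _ _ _ hy, extend_notMem_range]
        · rfl
        · rintro ⟨k, hk⟩
          exact hy ⟨k, h.injective hk⟩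
    · rw [extend_notMem_range _ _ _ hx, extend_notMem_range]
      rintro ⟨k, rfl⟩
      exact hx ⟨g k, rfl⟩

theorem siteOp_injective [NeZero d] (g : κ ↪ L) :
    Function.Injective (siteOp (d := d) g) := by
  classical
  intro M M' h
  ext a b
  let c₀ : Config L d := fun _ => 0
  -- Matrix elements between basis vectors over a common constant background recover the entries; `d
  -- ≠ 0` provides the background.
  have key : ∀ M : Matrix (κ → Fin d) (κ → Fin d) ℂ,
      siteOp g M (lp.single 2 (Function.extend g b c₀) 1) (Function.extend g a c₀) = M a b := by
    intro M
    rw [siteOp_apply, Finset.sum_eq_single b]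
    · rw [Function.extend_comp g.injective, extend_extend g.injective, lp.single_apply_self, mul_one]
    · intro b' _ hb'
      rw [extend_extend g.injective, lp.single_apply_ne, mul_zero]
      intro h'
      exact hb' (by simpa [Function.extend_comp g.injective] using congrArg (· ∘ g) h')
    · simp
  rw [← key M, ← key M', h]

/-- Both operators live on the finite region `κ ⊕ K`, which reduces the claim to finite matrices. -/
theorem siteOp_commute_of_disjoint (g : κ ↪ L) (h : K ↪ L) (hd : ∀ k l, g k ≠ h l)
    (M : Matrix (κ → Fin d) (κ → Fin d) ℂ) (M' : Matrix (K → Fin d) (K → Fin d) ℂ) :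
    Commute (siteOp g M) (siteOp h M') := by
  let e : κ ⊕ K ↪ L := ⟨Sum.elim g h, g.injective.sumElim h.injective hd⟩
  have h1 : g = (Function.Embedding.inl : κ ↪ κ ⊕ K).trans e := by ext; rfl
  have h2 : h = (Function.Embedding.inr : K ↪ κ ⊕ K).trans e := by ext; rfl
  rw [h1, h2, siteOp_trans, siteOp_trans]
  exact (emb_commute_of_disjoint Function.Embedding.inl.injective
    Function.Embedding.inr.injective (by simp) M M').map (siteHom e)

/-- The embedding `g` followed by the translation by `x`. -/
def shiftEmb [AddCommGroup L] (g : κ ↪ L) (x : L) : κ ↪ L :=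
  ⟨fun k => g k + x, fun _ _ h => g.injective (add_right_cancel h)⟩

theorem shiftOp_conj_siteOp [AddCommGroup L] (x : L) (g : κ ↪ L)
    (M : Matrix (κ → Fin d) (κ → Fin d) ℂ) :
    shiftOp x * siteOp g M * shiftOp (-x) = siteOp (shiftEmb g x) M := by
  ext ψ c
  change shiftOp x (siteOp g M (shiftOp (-x) ψ)) c = _
  rw [shiftOp_apply, siteOp_apply, siteOp_apply]
  refine Finset.sum_congr rfl fun b _ => ?_
  rw [shiftOp_apply]
  refine congrArg₂ (· * ·) rfl (congrArg ψ ?_)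
  funext z
  by_cases hz : z ∈ Set.range (shiftEmb g x)
  · obtain ⟨k, rfl⟩ := hz
    rw [(shiftEmb g x).injective.extend_apply]
    have : shiftEmb g x k + -x = g k := add_neg_cancel_right _ _
    rw [this, g.injective.extend_apply]
  · rw [extend_notMem_range _ _ _ hz, extend_notMem_range]
    · simp
    · rintro ⟨k, hk⟩
      exact hz ⟨k, (congrArg (· + x) hk).trans (neg_add_cancel_right z x)⟩

variable [DecidableEq L]

theorem siteOp_mem_localOps (g : κ ↪ L) {Ω : Finset L} (hg : ∀ k, g k ∈ Ω)
    (M : Matrix (κ → Fin d) (κ → Fin d) ℂ) : siteOp g M ∈ localOps d Ω :=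
  ⟨_, (siteOp_trans (⟨fun k => ⟨g k, hg k⟩, fun _ _ h => g.injective (congrArg Subtype.val h)⟩ :
    κ ↪ {x // x ∈ Ω}) (regionEmb Ω) M).symm⟩

theorem siteOp_mem_quasiLocal (g : κ ↪ L) (M : Matrix (κ → Fin d) (κ → Fin d) ℂ) :
    siteOp g M ∈ quasiLocal L d :=
  StarSubalgebra.le_topologicalClosure _ (StarAlgebra.subset_adjoin ℂ _
    (Set.mem_iUnion.2 ⟨_, siteOp_mem_localOps g
      (fun k => Finset.mem_map_of_mem g (Finset.mem_univ k)) M⟩))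

/-- `M ↦ M ⊗ I` as a homomorphism to the quasi-local algebra. -/
def qHom (g : κ ↪ L) : Matrix (κ → Fin d) (κ → Fin d) ℂ →⋆ₐ[ℂ] quasiLocal L d :=
  (siteHom g).codRestrict _ (siteOp_mem_quasiLocal g)

theorem regionOp_eq_qHom (Ω : Finset L) (M : Matrix ({x // x ∈ Ω} → Fin d) _ ℂ) :
    regionOp Ω M = qHom (regionEmb Ω) M := rfl

theorem qHom_injective [NeZero d] (g : κ ↪ L) : Function.Injective (qHom (d := d) g) :=
  fun _ _ h => siteOp_injective g (congrArg Subtype.val h)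

theorem qHom_trans (g : κ ↪ K) (h : K ↪ L) (M : Matrix (κ → Fin d) (κ → Fin d) ℂ) :
    qHom (g.trans h) M = qHom h (emb g M) := Subtype.ext (siteOp_trans g h M)

theorem qHom_commute_of_disjoint (g : κ ↪ L) (h : K ↪ L) (hd : ∀ k l, g k ≠ h l)
    (M : Matrix (κ → Fin d) (κ → Fin d) ℂ) (M' : Matrix (K → Fin d) (K → Fin d) ℂ) :
    Commute (qHom g M) (qHom h M') :=
  Subtype.ext (siteOp_commute_of_disjoint g h hd M M')

theorem shift_qHom [AddCommGroup L] (x : L) (g : κ ↪ L) (M : Matrix (κ → Fin d) (κ → Fin d) ℂ) :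
    shift x (qHom g M) = qHom (shiftEmb g x) M := Subtype.ext (shiftOp_conj_siteOp x g M)

/-- The embedding of a single cell. -/
def cellEmb (x : L) : Unit ↪ L := ⟨fun _ => x, fun _ _ _ => rfl⟩

theorem cellOp_eq_qHom (x : L) (a : Matrix (Fin d) (Fin d) ℂ) :
    cellOp x a = qHom (cellEmb x) (a.submatrix (fun k => k ()) (fun k => k ())) := by
  let e : Unit ↪ {y // y ∈ ({x} : Finset L)} :=
    ⟨fun _ => ⟨x, Finset.mem_singleton_self x⟩, fun _ _ _ => rfl⟩
  change _ = qHom (e.trans (regionEmb {x})) _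
  rw [qHom_trans, cellOp, regionOp_eq_qHom]
  congr 1
  ext c c'
  rw [emb_apply_of]
  · rfl
  · rintro ⟨y, hy⟩ h
    exact (h ⟨(), Subtype.ext (Finset.mem_singleton.1 hy).symm⟩).elim

theorem qHom_cell (g : κ ↪ L) (k : κ) (a : Matrix (Fin d) (Fin d) ℂ) :
    qHom g (cell k a) = cellOp (g k) a := by
  rw [cellOp_eq_qHom]
  exact (qHom_trans (cellEmb k) g _).symm

/-- The operators on the cell `x` as a homomorphism to the quasi-local algebra. -/
def cellOpHom (x : L) : Matrix (Fin d) (Fin d) ℂ →⋆ₐ[ℂ] quasiLocal L d :=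
  (qHom (cellEmb x)).comp (cellHom ())

theorem cellOpHom_apply (x : L) (a : Matrix (Fin d) (Fin d) ℂ) :
    cellOpHom x a = cellOp x a := qHom_cell (cellEmb x) () a

theorem shift_cellOp [AddCommGroup L] (x y : L) (a : Matrix (Fin d) (Fin d) ℂ) :
    shift x (cellOp y a) = cellOp (y + x) a := by
  rw [cellOp_eq_qHom, cellOp_eq_qHom, shift_qHom]; rfl

theorem cellOp_commute {x y : L} (h : x ≠ y) (a b : Matrix (Fin d) (Fin d) ℂ) :
    Commute (cellOp x a) (cellOp y b) := by
  rw [cellOp_eq_qHom, cellOp_eq_qHom]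
  exact qHom_commute_of_disjoint _ _ (fun _ _ => h) _ _

/-- The inclusion of a finite region in a larger one. -/
def subEmb {Ω Ω' : Finset L} (h : Ω ⊆ Ω') : {x // x ∈ Ω} ↪ {x // x ∈ Ω'} :=
  ⟨fun x => ⟨x.1, h x.2⟩, fun _ _ h => Subtype.ext (Subtype.mk.inj h)⟩

theorem regionOp_eq_of_subset {Ω Ω' : Finset L} (h : Ω ⊆ Ω')
    (M : Matrix ({x // x ∈ Ω} → Fin d) _ ℂ) : regionOp Ω M = regionOp Ω' (emb (subEmb h) M) :=
  qHom_trans (subEmb h) (regionEmb Ω') M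

/-- The local operators form a `*`-algebra. -/
theorem mem_adjoin_localOps {a : BOp L d} :
    a ∈ StarAlgebra.adjoin ℂ (⋃ Ω : Finset L, localOps d Ω) ↔
      ∃ (Ω : Finset L) (M : _), a = siteOp (regionEmb Ω) M := by
  constructor
  · intro ha
    have key : ∀ {a b : BOp L d}, (∃ (Ω : Finset L) (M : _), a = siteOp (regionEmb Ω) M) →
        (∃ (Ω : Finset L) (M : _), b = siteOp (regionEmb Ω) M) →
        ∃ (Ω : Finset L) (M M' : _), a = siteOp (regionEmb Ω) M ∧ b = siteOp (regionEmb Ω) M' := by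
      rintro a b ⟨Ω, M, rfl⟩ ⟨Ω', M', rfl⟩
      exact ⟨Ω ∪ Ω', _, _, congrArg Subtype.val (regionOp_eq_of_subset Finset.subset_union_left M),
        congrArg Subtype.val (regionOp_eq_of_subset Finset.subset_union_right M')⟩
    induction ha using StarAlgebra.adjoin_induction with
    | mem a ha =>
      obtain ⟨Ω, M, rfl⟩ := Set.mem_iUnion.1 ha
      exact ⟨Ω, M, rfl⟩
    | algebraMap r => exact ⟨∅, algebraMap ℂ _ r, (AlgHomClass.commutes (siteHom (regionEmb ∅)) r).symm⟩
    | add a b _ _ iha ihb =>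
      obtain ⟨Ω, M, M', rfl, rfl⟩ := key iha ihb
      exact ⟨Ω, M + M', (siteOp_add _ _ _).symm⟩
    | mul a b _ _ iha ihb =>
      obtain ⟨Ω, M, M', rfl, rfl⟩ := key iha ihb
      exact ⟨Ω, M * M', (siteOp_mul _ _ _).symm⟩
    | star a _ iha =>
      obtain ⟨Ω, M, rfl⟩ := iha
      exact ⟨Ω, star M, (siteOp_star _ _).symm⟩
  · rintro ⟨Ω, M, rfl⟩
    exact StarAlgebra.subset_adjoin ℂ _ (Set.mem_iUnion.2 ⟨Ω, M, rfl⟩)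

/-- A closed property of local operators holds on the quasi-local algebra. -/
theorem quasiLocal_induction {P : quasiLocal L d → Prop} (hP : IsClosed {a | P a})
    (hloc : ∀ (Ω : Finset L) (M : _), P (regionOp Ω M)) (a : quasiLocal L d) : P a := by
  have hd : Dense {a : quasiLocal L d | ∃ (Ω : Finset L) (M : _), a = regionOp Ω M} := by
    rw [Subtype.dense_iff]
    intro a ha
    refine closure_mono ?_ ha
    intro b hb
    obtain ⟨Ω, M, rfl⟩ := mem_adjoin_localOps.1 hb
    exact ⟨regionOp Ω M, ⟨Ω, M, rfl⟩, rfl⟩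
  refine hP.closure_subset_iff.2 ?_ (hd a)
  rintro _ ⟨Ω, M, rfl⟩
  exact hloc Ω M

end SiteOp

/-! ### Homomorphisms given by commuting images of the cells -/

section Extension

variable {α κ B : Type} [Fintype α] [DecidableEq α] [Fintype κ] [DecidableEq κ]
  [Ring B] [Algebra ℂ B] [StarRing B] [StarModule ℂ B]

theorem pairwise_commute {ρ : κ → Matrix α α ℂ →⋆ₐ[ℂ] B}
    (hρ : ∀ x y, x ≠ y → ∀ a b, Commute (ρ x a) (ρ y b)) (a : κ → Matrix α α ℂ) (s : Set κ) :
    s.Pairwise (Function.onFun Commute fun x => ρ x (a x)) := fun x _ y _ h => hρ x y h _ _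

theorem noncommProd_update {ρ : κ → Matrix α α ℂ →⋆ₐ[ℂ] B}
    (hρ : ∀ x y, x ≠ y → ∀ a b, Commute (ρ x a) (ρ y b)) (a : κ → Matrix α α ℂ) (x : κ)
    (v : Matrix α α ℂ) :
    Finset.univ.noncommProd (fun y => ρ y (Function.update a x v y)) (pairwise_commute hρ _ _)
      = ρ x v * (Finset.univ.erase x).noncommProd (fun y => ρ y (a y))
        (pairwise_commute hρ _ _) := by
  rw [← Finset.mul_noncommProd_erase _ (Finset.mem_univ x) _ _ (pairwise_commute hρ _ _)]
  congr 1
  · rw [Function.update_self]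
  · refine Finset.noncommProd_congr rfl (fun y hy => ?_) _
    rw [Function.update_of_ne (Finset.ne_of_mem_erase hy)]

/-- The product of the images of operators on all cells, as a multilinear map. -/
def prodMultilinear (ρ : κ → Matrix α α ℂ →⋆ₐ[ℂ] B)
    (hρ : ∀ x y, x ≠ y → ∀ a b, Commute (ρ x a) (ρ y b)) :
    MultilinearMap ℂ (fun _ : κ => Matrix α α ℂ) B :=
  .mk' (fun a => Finset.univ.noncommProd (fun x => ρ x (a x)) (pairwise_commute hρ _ _))
    (fun a x u v => by simp only [noncommProd_update hρ, map_add, add_mul])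
    (fun a x z v => by simp only [noncommProd_update hρ, map_smul, smul_mul_assoc])

variable (ρ : κ → Matrix α α ℂ →⋆ₐ[ℂ] B) (hρ : ∀ x y, x ≠ y → ∀ a b, Commute (ρ x a) (ρ y b))

theorem prodMultilinear_mul (a b : κ → Matrix α α ℂ) :
    prodMultilinear ρ hρ a * prodMultilinear ρ hρ b = prodMultilinear ρ hρ (fun x => a x * b x) := by
  refine (Finset.noncommProd_mul_distrib _ _ (pairwise_commute hρ _ _)
    (pairwise_commute hρ _ _) (fun x _ y _ h => hρ x y h _ _)).symm.trans ?_
  refine Finset.noncommProd_congr rfl (fun x _ => ?_) _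
  exact (map_mul (ρ x) _ _).symm

theorem prodMultilinear_one : prodMultilinear ρ hρ (fun _ => 1) = 1 :=
  (Finset.noncommProd_eq_pow_card _ _ (pairwise_commute hρ (fun _ => 1) _) 1
    fun x _ => map_one (ρ x)).trans (one_pow _)

theorem prodMultilinear_update_one (x : κ) (a : Matrix α α ℂ) :
    prodMultilinear ρ hρ (Function.update 1 x a) = ρ x a := by
  refine (noncommProd_update hρ _ x a).trans ?_
  rw [Finset.noncommProd_eq_pow_card _ _ _ 1 (fun y _ => by rw [Pi.one_apply, map_one]), one_pow,
    mul_one]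

/-- The linear map that takes `⊗ a x` to the product of the images of the `a x`. -/
def prodLinear : Matrix (κ → α) (κ → α) ℂ →ₗ[ℂ] B where
  toFun M := ∑ c, ∑ c', M c c' • prodMultilinear ρ hρ fun x => Matrix.single (c x) (c' x) 1
  map_add' M M' := by simp only [Matrix.add_apply, add_smul, Finset.sum_add_distrib]
  map_smul' z M := by
    simp only [Matrix.smul_apply, smul_eq_mul, mul_smul, Finset.smul_sum, RingHom.id_apply]

/-- The definition prescribes values on tensors of matrix units only. Expanding every factor in
matrix units gives a sum over functions κ → α × α, which are the same as pairs of configurations. -/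
theorem prodLinear_tens (a : κ → Matrix α α ℂ) :
    prodLinear ρ hρ (tens a) = prodMultilinear ρ hρ a := by
  have h : a = fun x => ∑ r : α × α, a x r.1 r.2 • Matrix.single r.1 r.2 (1 : ℂ) := by
    funext x
    conv_lhs => rw [Matrix.matrix_eq_sum_single (a x)]
    rw [Fintype.sum_prod_type]
    simp
  conv_rhs => rw [h, MultilinearMap.map_sum]
  simp only [MultilinearMap.map_smul_univ]
  rw [← (Equiv.arrowProdEquivProdArrow κ (fun _ => α) (fun _ => α)).symm.sum_comp,
    Fintype.sum_prod_type]
  rfl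

/-- Commuting homomorphisms on the cells extend to a homomorphism on all matrices. -/
theorem exists_hom_of_commute (ρ : κ → Matrix α α ℂ →⋆ₐ[ℂ] B)
    (hρ : ∀ x y, x ≠ y → ∀ a b, Commute (ρ x a) (ρ y b)) :
    ∃ F : Matrix (κ → α) (κ → α) ℂ →⋆ₐ[ℂ] B, ∀ x a, F (cell x a) = ρ x a := by
  have hone : prodLinear ρ hρ 1 = 1 := by
    rw [← tens_one, prodLinear_tens, prodMultilinear_one]
  have hmul : ∀ M M', prodLinear ρ hρ (M * M') = prodLinear ρ hρ M * prodLinear ρ hρ M' := by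
    intro M M'
    induction M using tens_induction with
    | htens a =>
      induction M' using tens_induction with
      | htens b => rw [tens_mul, prodLinear_tens, prodLinear_tens, prodLinear_tens,
          prodMultilinear_mul]
      | hadd A B hA hB => rw [mul_add, map_add, map_add, mul_add, hA, hB]
      | hsmul z A hA => rw [mul_smul_comm, map_smul, map_smul, mul_smul_comm, hA]
    | hadd A B hA hB => rw [add_mul, map_add, map_add, add_mul, hA, hB]
    | hsmul z A hA => rw [smul_mul_assoc, map_smul, map_smul, smul_mul_assoc, hA]
  have hcell : ∀ x a, prodLinear ρ hρ (cell x a) = ρ x a := by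
    intro x a
    rw [cell_eq_tens, prodLinear_tens, prodMultilinear_update_one]
  have hstar : ∀ M, prodLinear ρ hρ (star M) = star (prodLinear ρ hρ M) := by
    intro M
    induction M using cell_induction with
    | hone => rw [star_one, hone, star_one]
    | hcell x a =>
      have : star (cell x a) = cell x (star a) := (map_star (cellHom x) a).symm
      rw [this, hcell, hcell, map_star]
    | hadd A B hA hB => rw [star_add, map_add, map_add, star_add, hA, hB]
    | hmul A B hA hB => rw [star_mul, hmul, hmul, star_mul, hA, hB]
    | hsmul z A hA => rw [star_smul, map_smul, map_smul, star_smul, hA]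
  exact ⟨{ AlgHom.ofLinearMap (prodLinear ρ hρ) hone hmul with map_star' := hstar }, hcell⟩

/-- Homomorphisms that agree on the cells are equal. -/
theorem hom_ext_cell {F G : Matrix (κ → α) (κ → α) ℂ →⋆ₐ[ℂ] B}
    (h : ∀ x a, F (cell x a) = G (cell x a)) : F = G := by
  ext M
  induction M using cell_induction with
  | hone => rw [map_one, map_one]
  | hcell x a => exact h x a
  | hadd A B hA hB => rw [map_add, map_add, hA, hB]
  | hmul A B hA hB => rw [map_mul, map_mul, hA, hB]
  | hsmul z A hA => rw [map_smul, map_smul, hA]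

end Extension

/-- A bounded family of compatible linear maps on a directed dense family of subspaces has a
continuous extension. -/
theorem exists_continuous_extension {ι : Type} [DecidableEq ι] [Nonempty ι] {A : ι → Type}
    [∀ i, AddCommGroup (A i)] [∀ i, Module ℂ (A i)] {E E' : Type} [NormedAddCommGroup E]
    [NormedSpace ℂ E] [NormedAddCommGroup E'] [NormedSpace ℂ E'] [CompleteSpace E']
    (q : ∀ i, A i →ₗ[ℂ] E) (G : ∀ i, A i →ₗ[ℂ] E')
    (hdir : ∀ i j x y, ∃ k x' y', q i x = q k x' ∧ G i x = G k x' ∧ q j y = q k y' ∧ G j y = G k y')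
    (hnorm : ∀ i x, ‖G i x‖ ≤ ‖q i x‖) (hdense : Dense {a | ∃ i x, q i x = a}) :
    ∃ F : E →L[ℂ] E', ∀ i x, F (q i x) = G i x := by
  -- Both families are assembled on the direct sum of the `A i`; the extension is that of `f` along
  -- `e`, for which ‖f x‖ ≤ ‖e x‖ suffices.
  let e := DirectSum.toModule ℂ ι E q
  let f := DirectSum.toModule ℂ ι E' G
  have he : ∀ i x, e (DirectSum.lof ℂ ι A i x) = q i x := fun i x => DirectSum.toModule_lof ℂ i x
  have hf : ∀ i x, f (DirectSum.lof ℂ ι A i x) = G i x := fun i x => DirectSum.toModule_lof ℂ i x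
  -- By directedness every element of the direct sum has the same two images as a single summand, so
  -- the norm bound on the summands covers all of it.
  have hef : ∀ x, ∃ i y, e x = q i y ∧ f x = G i y := by
    intro x
    induction x using DirectSum.induction_on with
    | zero => exact ⟨Classical.arbitrary ι, 0, by simp, by simp⟩
    | of i x => exact ⟨i, x, he i x, hf i x⟩
    | add x y hx hy =>
      obtain ⟨i, u, h1, h2⟩ := hx
      obtain ⟨j, v, h1', h2'⟩ := hy
      obtain ⟨k, u', v', h3, h4, h5, h6⟩ := hdir i j u v
      exact ⟨k, u' + v', by rw [map_add, map_add, h1, h1', h3, h5],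
        by rw [map_add, map_add, h2, h2', h4, h6]⟩
  have hd : DenseRange e := by
    refine hdense.mono ?_
    rintro _ ⟨i, x, rfl⟩
    exact ⟨_, he i x⟩
  have hn : ∀ x, ‖f x‖ ≤ 1 * ‖e x‖ := by
    intro x
    obtain ⟨i, y, h1, h2⟩ := hef x
    rw [h1, h2, one_mul]
    exact hnorm i y
  refine ⟨f.extendOfNorm e, fun i x => ?_⟩
  rw [← he, LinearMap.extendOfNorm_eq hd ⟨1, hn⟩, hf]

/-! ### Extension to the quasi-local algebra by isometry. -/

section QuasiLocalExtension

open scoped Matrix.Norms.L2Operator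

theorem matrix_hom_injective {n B : Type} [Fintype n] [DecidableEq n] [Nonempty n] [Ring B]
    [Algebra ℂ B] [StarRing B] [Nontrivial B] (F : Matrix n n ℂ →⋆ₐ[ℂ] B) :
    Function.Injective F :=
  RingHom.injective (F : Matrix n n ℂ →+* B)

variable {L : Type} [DecidableEq L] {d : ℕ} [NeZero d]

instance : Nontrivial (BOp L d) :=
  haveI : Nonempty (Config L d) := ⟨fun _ => 0⟩
  (siteOp_injective (d := d) (L := L) (κ := Fin 0) ⟨Fin.elim0, fun x => x.elim0⟩).nontrivial

instance : IsClosed (quasiLocal L d : Set (BOp L d)) :=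
  StarSubalgebra.isClosed_topologicalClosure _

instance : CompleteSpace (quasiLocal L d) :=
  (StarSubalgebra.isClosed_topologicalClosure _).completeSpace_coe

/-- A full matrix algebra is simple, so both homomorphisms are injective, and injective
homomorphisms of C*-algebras are isometric. Both sides thus equal the operator norm of `M`. -/
theorem norm_matrix_hom_eq_norm_regionOp {Ω : Finset L}
    (F : Matrix ({x // x ∈ Ω} → Fin d) ({x // x ∈ Ω} → Fin d) ℂ →⋆ₐ[ℂ] quasiLocal L d)
    (M : Matrix ({x // x ∈ Ω} → Fin d) ({x // x ∈ Ω} → Fin d) ℂ) : ‖F M‖ = ‖regionOp Ω M‖ := by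
  rw [NonUnitalStarAlgHom.norm_map F (matrix_hom_injective F), regionOp_eq_qHom,
    NonUnitalStarAlgHom.norm_map (qHom (regionEmb Ω)) (qHom_injective _)]

/-- Commuting homomorphisms on the cells extend to an isometric homomorphism on the quasi-local
algebra. -/
theorem exists_quasiLocal_hom (ρ : L → Matrix (Fin d) (Fin d) ℂ →⋆ₐ[ℂ] quasiLocal L d)
    (hρ : ∀ x y, x ≠ y → ∀ a b, Commute (ρ x a) (ρ y b)) :
    ∃ F : quasiLocal L d →⋆ₐ[ℂ] quasiLocal L d, Isometry F ∧ ∀ x a, F (cellOp x a) = ρ x a := by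
  choose G hG using fun Ω : Finset L => exists_hom_of_commute (fun x : {x // x ∈ Ω} => ρ x)
    (fun x y h => hρ x y (fun h' => h (Subtype.ext h')))
  -- Compatibility of the local homomorphisms: they are determined by their values on cells.
  have hsub : ∀ {Ω Ω' : Finset L} (h : Ω ⊆ Ω') (M), G Ω M = G Ω' (emb (subEmb h) M) := by
    intro Ω Ω' h M
    have : G Ω = (G Ω').comp (embHom (subEmb h).injective) := by
      refine hom_ext_cell fun x a => ?_
      rw [StarAlgHom.comp_apply, embHom_apply, emb_cell (subEmb h).injective, hG, hG]
      rfl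
    rw [this]
    rfl
  let A : Finset L → Type := fun Ω => Matrix ({x // x ∈ Ω} → Fin d) ({x // x ∈ Ω} → Fin d) ℂ
  let q : ∀ Ω, A Ω →ₗ[ℂ] quasiLocal L d := fun Ω => (qHom (regionEmb Ω)).toAlgHom.toLinearMap
  let G' : ∀ Ω, A Ω →ₗ[ℂ] quasiLocal L d := fun Ω => (G Ω).toAlgHom.toLinearMap
  have hdense : Dense {a | ∃ Ω M, q Ω M = a} := fun a =>
    quasiLocal_induction (P := fun a => a ∈ closure {a | ∃ Ω M, q Ω M = a}) isClosed_closure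
      (fun Ω M => subset_closure ⟨Ω, M, rfl⟩) a
  obtain ⟨F, hF⟩ := exists_continuous_extension q G'
    (fun Ω Ω' M M' => ⟨Ω ∪ Ω', _, _, regionOp_eq_of_subset Finset.subset_union_left M,
      hsub Finset.subset_union_left M, regionOp_eq_of_subset Finset.subset_union_right M',
      hsub Finset.subset_union_right M'⟩)
    (fun Ω M => (norm_matrix_hom_eq_norm_regionOp (G Ω) M).le) hdense
  replace hF : ∀ Ω M, F (regionOp Ω M) = G Ω M := hF
  have hFc : Continuous F := F.continuous
  have hone : F 1 = 1 := by
    have h1 : (1 : quasiLocal L d) = regionOp ∅ 1 := (map_one (qHom (regionEmb ∅))).symm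
    rw [h1, hF, map_one, ← h1]
  have hunion : ∀ (Ω Ω' : Finset L) (M M' : _), ∃ (Ω'' : Finset L) (N N' : _),
      regionOp (d := d) Ω M = regionOp Ω'' N ∧ regionOp (d := d) Ω' M' = regionOp Ω'' N' :=
    fun Ω Ω' M M' => ⟨Ω ∪ Ω', _, _, regionOp_eq_of_subset Finset.subset_union_left M,
      regionOp_eq_of_subset Finset.subset_union_right M'⟩
  have hmul : ∀ a b, F (a * b) = F a * F b := by
    intro a b
    refine quasiLocal_induction (P := fun a => F (a * b) = F a * F b)
      (isClosed_eq (by fun_prop) (by fun_prop)) (fun Ω M => ?_) a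
    refine quasiLocal_induction (P := fun b => F (regionOp Ω M * b) = F (regionOp Ω M) * F b)
      (isClosed_eq (by fun_prop) (by fun_prop)) (fun Ω' M' => ?_) b
    obtain ⟨Ω'', N, N', h1, h2⟩ := hunion Ω Ω' M M'
    have h3 : regionOp Ω'' N * regionOp Ω'' N' = regionOp Ω'' (N * N') :=
      (map_mul (qHom (regionEmb Ω'')) N N').symm
    rw [h1, h2, h3, hF, hF, hF, map_mul]
  have hstar : ∀ a, F (star a) = star (F a) := by
    intro a
    refine quasiLocal_induction (P := fun a => F (star a) = star (F a))
      (isClosed_eq (by fun_prop) (by fun_prop)) (fun Ω M => ?_) a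
    have h3 : star (regionOp Ω M) = regionOp Ω (star M) :=
      (map_star (qHom (regionEmb Ω)) M).symm
    rw [h3, hF, hF, map_star]
  refine ⟨{ AlgHom.ofLinearMap F.toLinearMap hone hmul with map_star' := hstar }, ?_, ?_⟩
  · refine AddMonoidHomClass.isometry_of_norm _ fun a => ?_
    change ‖F a‖ = ‖a‖
    refine quasiLocal_induction (P := fun a => ‖F a‖ = ‖a‖)
      (isClosed_eq (by fun_prop) (by fun_prop)) (fun Ω M => ?_) a
    rw [hF, norm_matrix_hom_eq_norm_regionOp]
  · intro x a
    have h := qHom_cell (regionEmb {x}) ⟨x, Finset.mem_singleton_self x⟩ a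
    change F (cellOp x a) = _
    rw [← regionOp_eq_qHom] at h
    refine (congrArg F h.symm).trans ((hF _ _).trans ?_)
    rw [hG]

end QuasiLocalExtension

/-! ### Regular neighbourhood schemes -/

/-- `φ` is injective on sums of two differences of elements of `𝒩`. -/
def DiffInj {L L' : Type} [AddCommGroup L] [AddCommGroup L'] (φ : L →+ L') (𝒩 : Set L) : Prop :=
  ∀ n₁ ∈ 𝒩, ∀ n₂ ∈ 𝒩, ∀ n₃ ∈ 𝒩, ∀ n₄ ∈ 𝒩,
    φ (n₁ - n₂ + n₃ - n₄) = 0 → n₁ - n₂ + n₃ - n₄ = 0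

section Regular

variable {L L' : Type} [AddCommGroup L] [AddCommGroup L'] {φ : L →+ L'} {𝒩 : Set L}

/-- A common point of the two translates writes x − y as a difference of elements of 𝒩. A further
coincidence after wrapping then says that φ kills a sum of two differences, so the coincidence was
there before wrapping. -/
theorem DiffInj.isRegular (h : DiffInj φ 𝒩) : IsRegular φ 𝒩 := by
  rintro x y ⟨p, hpx, hpy⟩
  obtain ⟨n, hn, rfl⟩ := hpx
  obtain ⟨n', hn', hp⟩ := hpy
  simp only [vadd_eq_add] at hp
  ext z
  constructor
  · rintro ⟨⟨⟨_, ⟨k, hk, rfl⟩, hkz⟩, ⟨_, ⟨l, hl, rfl⟩, hlz⟩⟩, hz⟩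
    simp only [vadd_eq_add] at hkz hlz
    rcases hz with ⟨u, hu, rfl⟩ | ⟨u, hu, rfl⟩
    · refine ⟨⟨u, hu, rfl⟩, ⟨l, hl, ?_⟩⟩
      have h1 : x = y + n' - n := eq_sub_of_add_eq hp.symm
      have h0 : u - l + n' - n = 0 := by
        refine h u hu l hl n' hn' n hn ?_
        simp only [vadd_eq_add, h1, map_add, map_sub] at hlz ⊢
        have : φ l = φ n' - φ n + φ u := by
          refine add_left_cancel (a := φ y) ?_
          rw [hlz]; abel
        rw [this]; abel
      simp only [vadd_eq_add, h1]
      have : l = u + n' - n := by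
        rw [← sub_eq_zero, ← neg_eq_zero, ← h0]; abel
      rw [this]; abel
    · refine ⟨⟨k, hk, ?_⟩, ⟨u, hu, rfl⟩⟩
      have h1 : y = x + n - n' := eq_sub_of_add_eq hp
      have h0 : u - k + n - n' = 0 := by
        refine h u hu k hk n hn n' hn' ?_
        simp only [vadd_eq_add, h1, map_add, map_sub] at hkz ⊢
        have : φ k = φ n - φ n' + φ u := by
          refine add_left_cancel (a := φ x) ?_
          rw [hkz]; abel
        rw [this]; abel
      simp only [vadd_eq_add, h1]
      have : k = u + n - n' := by
        rw [← sub_eq_zero, ← neg_eq_zero, ← h0]; abel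
      rw [this]; abel
  · rintro ⟨⟨u, hu, rfl⟩, ⟨v, hv, hvu⟩⟩
    refine ⟨⟨⟨φ u, ⟨u, hu, rfl⟩, by simp⟩, ⟨φ v, ⟨v, hv, rfl⟩, ?_⟩⟩, Or.inl ⟨u, hu, rfl⟩⟩
    rw [← hvu]; simp

theorem IsRegular.mem_of_map_eq (h : IsRegular φ 𝒩) {y u v n : L} (hu : u ∈ 𝒩) (hv : v ∈ 𝒩)
    (hn : n ∈ 𝒩) (hny : n ∈ y +ᵥ 𝒩) (huv : φ u = φ (y + v)) : u ∈ y +ᵥ 𝒩 := by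
  have := h 0 y ⟨n, by rwa [zero_vadd], hny⟩
  have hmem : u ∈ ((0 : L) +ᵥ 𝒩) ∩ (y +ᵥ 𝒩) := by
    rw [← this]
    refine ⟨⟨⟨φ u, ⟨u, hu, rfl⟩, by simp⟩, ⟨φ v, ⟨v, hv, rfl⟩, by rw [huv]; simp⟩⟩, Or.inl ?_⟩
    rwa [zero_vadd]
  exact hmem.2

/-- If φ n₁ = φ n₂ with v = n₁ − n₂ ≠ 0, then 𝒩 and 𝒩 − v meet at n₂ and have the same image, so
regularity forces 𝒩 + v ⊆ 𝒩. In a torsion-free group no nonempty finite set allows this. -/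
theorem IsRegular.injOn [IsAddTorsionFree L] (h : IsRegular φ 𝒩) (hfin : 𝒩.Finite) :
    Set.InjOn φ 𝒩 := by
  intro n₁ h₁ n₂ h₂ h12
  by_contra hne
  have hv : n₁ - n₂ ≠ 0 := sub_ne_zero.2 hne
  have hφ : φ (n₂ - n₁) = 0 := by rw [map_sub, h12, sub_self]
  have step : ∀ u ∈ 𝒩, u + (n₁ - n₂) ∈ 𝒩 := by
    intro u hu
    obtain ⟨w, hw, hwu⟩ := h.mem_of_map_eq (y := n₂ - n₁) hu hu h₂ ⟨n₁, h₁, by simp⟩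
      (by rw [map_add, hφ, zero_add])
    have : w = u + (n₁ - n₂) := by
      simp only [vadd_eq_add] at hwu
      rw [← hwu]; abel
    exact this ▸ hw
  have hall : ∀ k : ℕ, n₁ + k • (n₁ - n₂) ∈ 𝒩 := by
    intro k
    induction k with
    | zero => simpa using h₁
    | succ k ih => rw [succ_nsmul, ← add_assoc]; exact step _ ih
  refine Set.infinite_of_injective_forall_mem (f := fun k : ℕ => n₁ + k • (n₁ - n₂)) ?_ hall hfin
  intro k l hkl
  exact injective_nsmul_iff_not_isOfFinAddOrder.2 (not_isOfFinAddOrder_of_isAddTorsionFree hv)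
    (add_left_cancel hkl)

/-- The schemes 𝒩 and (n₄ − n₃) + 𝒩 meet at n₄, so regularity gives n₁ = n₄ − n₃ + n₅ with n₅ in 𝒩,
and injectivity of φ on 𝒩 identifies n₅ with n₂. -/
theorem IsRegular.diffInj [IsAddTorsionFree L] (h : IsRegular φ 𝒩) (hfin : 𝒩.Finite) :
    DiffInj φ 𝒩 := by
  intro n₁ h₁ n₂ h₂ n₃ h₃ n₄ h₄ h0
  have heq : φ n₁ = φ (n₄ - n₃ + n₂) := by
    rw [← sub_eq_zero, ← map_sub, ← h0]; congr 1; abel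
  obtain ⟨n₅, h₅, h15⟩ := h.mem_of_map_eq (y := n₄ - n₃) h₁ h₂ h₄ ⟨n₃, h₃, by simp⟩ heq
  simp only [vadd_eq_add] at h15
  have : n₅ = n₂ := h.injOn hfin h₅ h₂ <| by
    rw [← h15, map_add, map_add] at heq
    exact add_left_cancel heq
  rw [← h15, this]; abel

theorem DiffInj.injOn_sub (h : DiffInj φ 𝒩) : Set.InjOn φ (𝒩 - 𝒩) := by
  rintro _ ⟨a, ha, b, hb, rfl⟩ _ ⟨c, hc, e, he, rfl⟩ hxy
  have h0 := h a ha b hb e he c hc (by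
    simp only [map_sub, map_add] at hxy ⊢
    have : φ a = φ c - φ e + φ b := eq_add_of_sub_eq hxy
    rw [this]; abel)
  change a - b = c - e
  rw [← sub_eq_zero, ← h0]; abel

theorem DiffInj.injOn (h : DiffInj φ 𝒩) : Set.InjOn φ 𝒩 := by
  intro a ha b hb hab
  have := h a ha b hb b hb b hb (by simp [hab])
  simpa [sub_eq_zero] using this

/-- Neighbourhoods that meet are wrapped injectively. -/
theorem DiffInj.injOn_union (h : DiffInj φ 𝒩) {x y : L} {n n' : L} (hn : n ∈ 𝒩) (hn' : n' ∈ 𝒩)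
    (hxy : n + x = n' + y) : Set.InjOn φ ((𝒩 + {x}) ∪ (𝒩 + {y})) := by
  -- Seen from the common point, both neighbourhoods consist of differences.
  have hsub : (𝒩 + {x}) ∪ (𝒩 + {y}) ⊆ (𝒩 - 𝒩) + {n + x} := by
    rw [Set.add_singleton, Set.add_singleton]
    rintro _ (⟨u, hu, rfl⟩ | ⟨u, hu, rfl⟩)
    · refine ⟨u - n, Set.sub_mem_sub hu hn, n + x, rfl, ?_⟩
      change u - n + (n + x) = u + x
      abel
    · refine ⟨u - n', Set.sub_mem_sub hu hn', n + x, rfl, ?_⟩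
      change u - n' + (n + x) = u + y
      rw [hxy]; abel
  refine Set.InjOn.mono hsub ?_
  rintro _ ⟨u, hu, _, rfl, rfl⟩ _ ⟨v, hv, _, rfl, rfl⟩ huv
  simp only [map_add] at huv
  rw [h.injOn_sub hu hv (add_right_cancel huv)]

theorem injOn_of_add_right {𝒩 Ω : Set L} (h : Set.InjOn φ (Ω + 𝒩)) (hne : 𝒩.Nonempty) :
    Set.InjOn φ Ω := by
  obtain ⟨n, hn⟩ := hne
  intro a ha b hb hab
  exact add_right_cancel (h (Set.add_mem_add ha hn) (Set.add_mem_add hb hn)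
    (by rw [map_add, map_add, hab]))

/-- A fixed element of ℳ translates 𝒩 into ℳ + 𝒩, and translations cancel in the alternating sum.
This passes from the scheme of T^N to that of T. -/
theorem DiffInj.of_add {𝒩 ℳ : Set L} (h : DiffInj φ (ℳ + 𝒩)) (hne : ℳ.Nonempty) :
    DiffInj φ 𝒩 := by
  obtain ⟨n, hn⟩ := hne
  intro a ha b hb c hc e he h0
  have e1 : n + a - (n + b) + (n + c) - (n + e) = a - b + c - e := by abel
  have := h (n + a) (Set.add_mem_add hn ha) (n + b) (Set.add_mem_add hn hb) (n + c)
    (Set.add_mem_add hn hc) (n + e) (Set.add_mem_add hn he) (by rw [e1, h0])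
  rwa [e1] at this

end Regular

/-! ### Transition rules -/

/-- A homomorphism whose values lie in the range of an injective one factors through it. -/
theorem exists_hom_lift {A B C : Type} [Ring A] [StarRing A] [Algebra ℂ A] [Ring B] [StarRing B]
    [Algebra ℂ B] [Ring C] [StarRing C] [Algebra ℂ C] (f : A →⋆ₐ[ℂ] C) (i : B →⋆ₐ[ℂ] C)
    (hi : Function.Injective i) (h : ∀ a, ∃ b, i b = f a) :
    ∃ g : A →⋆ₐ[ℂ] B, ∀ a, i (g a) = f a := by
  choose g hg using h
  refine ⟨{ toFun := g, map_one' := hi ?_, map_mul' := fun a b => hi ?_, map_zero' := hi ?_,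
            map_add' := fun a b => hi ?_, commutes' := fun z => hi ?_,
            map_star' := fun a => hi ?_ }, hg⟩
  · rw [hg, map_one, map_one]
  · rw [hg, map_mul, map_mul, hg, hg]
  · rw [hg, map_zero, map_zero]
  · rw [hg, map_add, map_add, hg, hg]
  · rw [hg, AlgHomClass.commutes, AlgHomClass.commutes]
  · rw [hg, map_star, map_star, hg]

section Rule

variable {L L' : Type} [AddCommGroup L] [DecidableEq L] [AddCommGroup L'] [Fintype L']
  [DecidableEq L'] {d : ℕ} {𝒩 : Finset L}

theorem shiftEmb_zero {κ : Type} (g : κ ↪ L) : shiftEmb g 0 = g :=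
  Function.Embedding.ext fun _ => add_zero _

/-- An automaton has a transition rule, the same for all cells. -/
theorem QCA.exists_rule [NeZero d] (T : QCA L d) :
    ∃ ρ : Matrix (Fin d) (Fin d) ℂ →⋆ₐ[ℂ]
        Matrix ({x // x ∈ T.nbhd} → Fin d) ({x // x ∈ T.nbhd} → Fin d) ℂ,
      ∀ x a, T.toEquiv (cellOp x a) = qHom (shiftEmb (regionEmb T.nbhd) x) (ρ a) := by
  obtain ⟨ρ, hρ⟩ := exists_hom_lift ((T.toEquiv : quasiLocal L d →⋆ₐ[ℂ] quasiLocal L d).comp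
    (cellOpHom 0)) (qHom (regionEmb T.nbhd)) (qHom_injective _) (fun a => by
      have h := T.locality {0} (cellOp 0 a) ⟨_, rfl⟩
      rw [Finset.singleton_zero, zero_add] at h
      obtain ⟨M, hM⟩ := h
      refine ⟨M, Subtype.ext ?_⟩
      rw [StarAlgHom.comp_apply, cellOpHom_apply]
      exact hM)
  refine ⟨ρ, fun x a => ?_⟩
  rw [← shift_qHom, hρ, StarAlgHom.comp_apply, cellOpHom_apply]
  have : cellOp x a = shift x (cellOp 0 a) := by rw [shift_cellOp, zero_add]
  rw [this, T.homogeneity]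
  rfl

/-- Both operators live on one finite region that is wrapped injectively, and on either lattice
commutation is decided in the matrix algebra of that region. The equivalence serves in one direction
to construct wrapped evolutions and in the other to unwrap. -/
theorem commute_wrap_iff [NeZero d] {φ : L →+ L'} {x y : L}
    (hφ : Set.InjOn φ (((𝒩 : Set L) + {x}) ∪ ((𝒩 : Set L) + {y})))
    (M M' : Matrix ({n // n ∈ 𝒩} → Fin d) ({n // n ∈ 𝒩} → Fin d) ℂ) :
    Commute (qHom (shiftEmb (regionEmb 𝒩) x) M) (qHom (shiftEmb (regionEmb 𝒩) y) M') ↔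
      Commute (emb (fun n : {n // n ∈ 𝒩} => φ n + φ x) M)
        (emb (fun n : {n // n ∈ 𝒩} => φ n + φ y) M') := by
  let K : Finset L := (𝒩 + {x}) ∪ (𝒩 + {y})
  have hK : ∀ a : {z // z ∈ K}, (a : L) ∈ ((𝒩 : Set L) + {x}) ∪ ((𝒩 : Set L) + {y}) := by
    intro a
    have := Finset.mem_coe.2 a.2
    rwa [Finset.coe_union, Finset.coe_add, Finset.coe_add, Finset.coe_singleton,
      Finset.coe_singleton] at this
  let i : {n // n ∈ 𝒩} ↪ {z // z ∈ K} := ⟨fun n => ⟨n + x, Finset.mem_union_left _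
    (Finset.add_mem_add n.2 (Finset.mem_singleton_self x))⟩,
    fun a b h => Subtype.ext (add_right_cancel (Subtype.mk.inj h))⟩
  let j : {n // n ∈ 𝒩} ↪ {z // z ∈ K} := ⟨fun n => ⟨n + y, Finset.mem_union_right _
    (Finset.add_mem_add n.2 (Finset.mem_singleton_self y))⟩,
    fun a b h => Subtype.ext (add_right_cancel (Subtype.mk.inj h))⟩
  let e : {z // z ∈ K} → L' := fun z => φ z
  have he : e.Injective := fun a b h => Subtype.ext (hφ (hK a) (hK b) h)
  have h1 : shiftEmb (regionEmb 𝒩) x = i.trans (regionEmb K) := rfl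
  have h2 : shiftEmb (regionEmb 𝒩) y = j.trans (regionEmb K) := rfl
  have h3 : (fun n : {n // n ∈ 𝒩} => φ n + φ x) = e ∘ i := by
    funext n; exact (map_add φ _ _).symm
  have h4 : (fun n : {n // n ∈ 𝒩} => φ n + φ y) = e ∘ j := by
    funext n; exact (map_add φ _ _).symm
  rw [h1, h2, h3, h4, qHom_trans, qHom_trans, emb_comp he, emb_comp he]
  have ha : ∀ X Y : Matrix ({z // z ∈ K} → Fin d) ({z // z ∈ K} → Fin d) ℂ,
      Commute (qHom (regionEmb K) X) (qHom (regionEmb K) Y) ↔ Commute X Y := fun X Y =>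
    ⟨fun h => h.of_map (qHom_injective _), fun h => h.map _⟩
  have hb : ∀ X Y : Matrix ({z // z ∈ K} → Fin d) ({z // z ∈ K} → Fin d) ℂ,
      Commute (emb e X) (emb e Y) ↔ Commute X Y := fun X Y =>
    ⟨fun h => Commute.of_map (f := embHom he) (emb_injective he) h, fun h => h.map (embHom he)⟩
  rw [ha, hb]

/-- A rule given on one cell defines a local and homogeneous automaton on a finite lattice. -/
theorem exists_finQCA_of_rule {κ : Type} [Fintype κ] [DecidableEq κ]
    (F : MatAlg L' d ≃⋆ₐ[ℂ] MatAlg L' d) (𝒩 : Finset L') (g : κ → L') (hg : ∀ k, g k ∈ 𝒩)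
    (θ : Matrix (Fin d) (Fin d) ℂ → Matrix (κ → Fin d) (κ → Fin d) ℂ)
    (h : ∀ x a, F (cell x a) = emb (fun k => g k + x) (θ a)) :
    ∃ Q : FinQCA L' d, Q.toEquiv = F ∧ Q.nbhd = 𝒩 := by
  refine ⟨⟨F, 𝒩, ?_, ?_⟩, rfl, rfl⟩
  · rintro Ω _ ⟨M, rfl⟩
    let i (Ω : Finset L') : {x // x ∈ Ω} → L' := Subtype.val
    have hi (Ω) : (i Ω).Injective := Subtype.val_injective
    change ∃ M', embHom (hi (Ω + 𝒩)) M' = F (embHom (hi Ω) M)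
    induction M using cell_induction with
    | hone => exact ⟨1, by rw [map_one, map_one, map_one]⟩
    | hcell x a =>
      let j : κ → {z // z ∈ Ω + 𝒩} := fun k => ⟨g k + x, by
        rw [add_comm (g k)]; exact Finset.add_mem_add x.2 (hg k)⟩
      refine ⟨emb j (θ a), ?_⟩
      rw [embHom_apply, embHom_apply, emb_cell (hi Ω), h, ← emb_comp (hi _)]
      rfl
    | hadd A B hA hB =>
      obtain ⟨A', hA⟩ := hA
      obtain ⟨B', hB⟩ := hB
      exact ⟨A' + B', by rw [map_add, map_add, map_add, hA, hB]⟩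
    | hmul A B hA hB =>
      obtain ⟨A', hA⟩ := hA
      obtain ⟨B', hB⟩ := hB
      exact ⟨A' * B', by rw [map_mul, map_mul, map_mul, hA, hB]⟩
    | hsmul z A hA =>
      obtain ⟨A', hA⟩ := hA
      exact ⟨z • A', by rw [map_smul, map_smul, map_smul, hA]⟩
  · intro x A
    let e : Config L' d ≃ Config L' d :=
      { toFun := fun c y => c (y + x)
        invFun := fun c y => c (y - x)
        left_inv := fun c => by simp
        right_inv := fun c => by simp }
    have hs : ∀ A : MatAlg L' d, shiftMat x A = A.submatrix e e := fun _ => rfl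
    have hcell : ∀ {κ : Type} (g : κ → L') (M : Matrix (κ → Fin d) (κ → Fin d) ℂ),
        shiftMat x (emb g M) = emb (fun k => g k + x) M := fun g M => emb_shift x g M
    induction A using cell_induction with
    | hone => simp only [hs, Matrix.submatrix_one_equiv, map_one]
    | hcell y a =>
      have h1 : shiftMat x (cell y a) = cell (y + x) a := hcell _ _
      rw [h1, h, h, hcell]
      simp only [add_assoc]
    | hadd A B hA hB =>
      have : shiftMat x (A + B) = shiftMat x A + shiftMat x B := rfl
      rw [this, map_add, map_add, hA, hB]; rfl
    | hmul A B hA hB =>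
      have : ∀ A B : MatAlg L' d, shiftMat x (A * B) = shiftMat x A * shiftMat x B := fun A B =>
        (Matrix.submatrix_mul_equiv A B e e e).symm
      rw [this, map_mul, map_mul, hA, hB, this]
    | hsmul z A hA =>
      have : shiftMat x (z • A) = z • shiftMat x A := rfl
      rw [this, map_smul, map_smul, hA]; rfl

/-- An automaton on a finite lattice has the same transition rule on all cells. -/
theorem FinQCA.rule_of_zero (Q : FinQCA L' d) {κ : Type} (g : κ → L')
    (a : Matrix (Fin d) (Fin d) ℂ) (M : Matrix (κ → Fin d) (κ → Fin d) ℂ)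
    (h : Q.toEquiv (cellMat 0 a) = siteMat g M) (x : L') :
    Q.toEquiv (cell x a) = emb (fun k => g k + x) M := by
  have h1 : cell x a = shiftMat x (cellMat 0 a) := by
    rw [shiftMat, cellMat_eq_cell, cell, cell, emb_shift]
    simp only [zero_add]
  rw [h1, Q.homogeneity, h]
  exact emb_shift x g M

end Rule

/-! ### Wrapped evolutions and their comparison with the infinite lattice. -/

section Lat

variable {s d m : ℕ} [NeZero m]

theorem wrap_surjective (s m : ℕ) : Function.Surjective (wrap s m) := by
  intro x
  choose y hy using fun t => ZMod.intCast_surjective (x t)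
  exact ⟨y, funext hy⟩

/-- `IsWrapped` supplies a matrix for each `a` separately; injectivity of M ↦ M ⊗ I identifies it
with the value of the rule, and homogeneity carries it to all cells. -/
theorem IsWrapped.rule [NeZero d] {T : QCA (Lat s) d} {Tw : FinQCA (Torus s m) d}
    (h : IsWrapped T Tw)
    {ρ : Matrix (Fin d) (Fin d) ℂ →⋆ₐ[ℂ]
        Matrix ({x // x ∈ T.nbhd} → Fin d) ({x // x ∈ T.nbhd} → Fin d) ℂ}
    (hρ : ∀ x a, T.toEquiv (cellOp x a) = qHom (shiftEmb (regionEmb T.nbhd) x) (ρ a))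
    (x : Torus s m) (a : Matrix (Fin d) (Fin d) ℂ) :
    Tw.toEquiv (cell x a) = emb (fun n : {n // n ∈ T.nbhd} => wrap s m n + x) (ρ a) := by
  obtain ⟨M, hM, hMw⟩ := h.2.2 a
  have : M = ρ a := by
    refine qHom_injective (regionEmb T.nbhd) (hM.symm.trans ((hρ 0 a).trans ?_))
    rw [shiftEmb_zero]
  subst this
  exact Tw.rule_of_zero _ a _ hMw x

/-- The wrapped evolution exists on every lattice over which the scheme is regular. -/
theorem exists_isWrapped [NeZero d] (T : QCA (Lat s) d)
    (hreg : IsRegular (wrap s m) (T.nbhd : Set (Lat s))) :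
    ∃ Tw : FinQCA (Torus s m) d, IsWrapped T Tw := by
  obtain ⟨ρ, hρ⟩ := T.exists_rule
  have hdiff := hreg.diffInj T.nbhd.finite_toSet
  have hinj : ∀ x : Torus s m,
      Function.Injective fun n : {n // n ∈ T.nbhd} => wrap s m n + x := fun x a b h =>
    Subtype.ext (hdiff.injOn a.2 b.2 (add_right_cancel h))
  obtain ⟨F, hF⟩ := exists_hom_of_commute (fun x : Torus s m => (embHom (hinj x)).comp ρ) (by
    intro x' y' hne a b
    simp only [StarAlgHom.comp_apply, embHom_apply]
    by_cases hd : ∀ k l : {n // n ∈ T.nbhd}, wrap s m k + x' ≠ wrap s m l + y'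
    · exact emb_commute_of_disjoint (hinj x') (hinj y') hd _ _
    · push Not at hd
      obtain ⟨k, l, hkl⟩ := hd
      obtain ⟨x, rfl⟩ := wrap_surjective s m x'
      -- The lift of `y'` is chosen so that the unwrapped neighbourhoods share the point k + x;
      -- there the images commute because T is a homomorphism.
      have hy : y' = wrap s m (k + x - l) := by
        rw [map_sub, map_add, hkl]; simp
      subst hy
      rw [← commute_wrap_iff (hdiff.injOn_union k.2 l.2 (by abel)), ← hρ, ← hρ]
      refine (cellOp_commute ?_ a b).map T.toEquiv
      intro h
      exact hne (congrArg _ h))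
  have hFinj : Function.Injective F :=
    haveI : Nonempty (Torus s m → Fin d) := ⟨fun _ => 0⟩
    matrix_hom_injective F
  have hFbij : Function.Bijective F :=
    ⟨hFinj, LinearMap.injective_iff_surjective (f := F.toAlgHom.toLinearMap).1 hFinj⟩
  obtain ⟨Tw, hTw, hn⟩ := exists_finQCA_of_rule (StarAlgEquiv.ofBijective F hFbij)
    (T.nbhd.image (wrap s m)) (fun n : {n // n ∈ T.nbhd} => wrap s m n)
    (fun k => Finset.mem_image_of_mem _ k.2) ρ hF
  refine ⟨Tw, hreg, hn, fun a => ⟨ρ a, ?_, ?_⟩⟩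
  · rw [hρ, regionOp_eq_qHom, shiftEmb_zero]
  · rw [hTw]
    refine (hF 0 a).trans ?_
    rw [siteMat_eq_emb]
    simp only [add_zero, StarAlgHom.comp_apply, embHom_apply]

/-- A homomorphism on the infinite lattice and one on a wrapped lattice with the same rule have the
same action on every region whose neighbourhood is wrapped injectively. -/
theorem exists_local_image [NeZero d] {𝒩 : Finset (Lat s)} (hne : 𝒩.Nonempty)
    (F : quasiLocal (Lat s) d →⋆ₐ[ℂ] quasiLocal (Lat s) d)
    (ρ : Matrix (Fin d) (Fin d) ℂ → Matrix ({n // n ∈ 𝒩} → Fin d) ({n // n ∈ 𝒩} → Fin d) ℂ)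
    (hF : ∀ x a, F (cellOp x a) = qHom (shiftEmb (regionEmb 𝒩) x) (ρ a))
    (Ω : Finset (Lat s)) (M : Matrix ({x // x ∈ Ω} → Fin d) ({x // x ∈ Ω} → Fin d) ℂ) :
    ∃ M', F (regionOp Ω M) = regionOp (Ω + 𝒩) M' ∧
      ∀ (m : ℕ) [NeZero m] (F' : MatAlg (Torus s m) d →⋆ₐ[ℂ] MatAlg (Torus s m) d),
        (∀ x a, F' (cell x a) = emb (fun n : {n // n ∈ 𝒩} => wrap s m n + x) (ρ a)) →
        Set.InjOn (wrap s m) ((Ω : Set (Lat s)) + 𝒩) →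
        F' (emb (fun x : {x // x ∈ Ω} => wrap s m x) M)
          = emb (fun x : {x // x ∈ Ω + 𝒩} => wrap s m x) M' := by
  have hj : ∀ {m : ℕ}, Set.InjOn (wrap s m) ((Ω : Set (Lat s)) + 𝒩) →
      Function.Injective (fun x : {x // x ∈ Ω + 𝒩} => wrap s m x) := fun h a b hab =>
    Subtype.ext (h (by simpa using Finset.mem_coe.2 a.2) (by simpa using Finset.mem_coe.2 b.2) hab)
  have hi : ∀ {m : ℕ}, Set.InjOn (wrap s m) ((Ω : Set (Lat s)) + 𝒩) →
      Function.Injective (fun x : {x // x ∈ Ω} => wrap s m x) := fun h a b hab =>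
    Subtype.ext (injOn_of_add_right h hne a.2 b.2 hab)
  simp only [regionOp_eq_qHom]
  -- Every case builds `M'` without reference to `m`, so one matrix serves all wrapped lattices.
  induction M using cell_induction with
  | hone =>
    refine ⟨1, by simp only [map_one], fun m _ F' _ h => ?_⟩
    rw [emb_one, emb_one, map_one]
  | hcell x a =>
    let i : {n // n ∈ 𝒩} ↪ {z // z ∈ Ω + 𝒩} := ⟨fun n => ⟨n + x, by
      rw [add_comm n.1]; exact Finset.add_mem_add x.2 n.2⟩,
      fun a b h => Subtype.ext (add_right_cancel (Subtype.mk.inj h))⟩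
    refine ⟨emb i (ρ a), ?_, fun m _ F' hF' h => ?_⟩
    · rw [qHom_cell, hF, ← qHom_trans]; rfl
    · rw [emb_cell (hi h), hF', ← emb_comp (hj h)]
      congr 1
      funext n
      exact (map_add (wrap s m) _ _).symm
  | hadd A B hA hB =>
    obtain ⟨A', hA, hA'⟩ := hA
    obtain ⟨B', hB, hB'⟩ := hB
    refine ⟨A' + B', by simp only [map_add, hA, hB], fun m _ F' hF' h => ?_⟩
    rw [emb_add, emb_add, map_add, hA' m F' hF' h, hB' m F' hF' h]
  | hmul A B hA hB =>
    obtain ⟨A', hA, hA'⟩ := hA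
    obtain ⟨B', hB, hB'⟩ := hB
    refine ⟨A' * B', by simp only [map_mul, hA, hB], fun m _ F' hF' h => ?_⟩
    rw [emb_mul (hi h), emb_mul (hj h), map_mul, hA' m F' hF' h, hB' m F' hF' h]
  | hsmul z A hA =>
    obtain ⟨A', hA, hA'⟩ := hA
    refine ⟨z • A', by simp only [map_smul, hA], fun m _ F' hF' h => ?_⟩
    rw [emb_smul, emb_smul, map_smul, hA' m F' hF' h]

end Lat

/-! ### Tiles -/

/-- Reindexing of matrices as an isomorphism of `*`-algebras. -/
def reindexStar {m n : Type} [Fintype m] [DecidableEq m] [Fintype n] [DecidableEq n] (e : m ≃ n) :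
    Matrix n n ℂ ≃⋆ₐ[ℂ] Matrix m m ℂ where
  toFun A := A.submatrix e e
  invFun A := A.submatrix e.symm e.symm
  left_inv A := by simp
  right_inv A := by simp
  map_mul' A B := (Matrix.submatrix_mul_equiv A B e e e).symm
  map_add' _ _ := rfl
  map_smul' _ _ := rfl
  map_star' _ := rfl

theorem reindexStar_apply {m n : Type} [Fintype m] [DecidableEq m] [Fintype n] [DecidableEq n]
    (e : m ≃ n) (A : Matrix n n ℂ) : reindexStar e A = A.submatrix e e := rfl

/-- Iterates of an automorphism. -/
def iterEquiv {A : Type} [Ring A] [StarRing A] [Algebra ℂ A] (e : A ≃⋆ₐ[ℂ] A) : ℕ → (A ≃⋆ₐ[ℂ] A)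
  | 0 => StarAlgEquiv.refl ℂ A
  | n + 1 => (iterEquiv e n).trans e

theorem iterEquiv_apply {A : Type} [Ring A] [StarRing A] [Algebra ℂ A] (e : A ≃⋆ₐ[ℂ] A) (n : ℕ)
    (a : A) : iterEquiv e n a = e^[n] a := by
  induction n with
  | zero => rfl
  | succ n ih =>
    rw [Function.iterate_succ_apply', ← ih]
    rfl

section Tiles

variable {s N f d : ℕ} [NeZero N] [NeZero f]

/-- The cell `k` of the tile `x`. -/
def tileCell (s N f : ℕ) (p : Torus s f × (Fin s → Fin N)) : Torus s (N * f) :=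
  fun t => ((N * (p.1 t).val + (p.2 t : ℕ) : ℕ) : ZMod (N * f))

/-- Each coordinate N q + r with q < f and r < N stays below N f, so there is no wrap-around and
division with remainder recovers q and r. -/
theorem tileCell_injective : Function.Injective (tileCell s N f) := by
  rintro ⟨x, k⟩ ⟨y, l⟩ h
  have key : ∀ t, (x t).val = (y t).val ∧ (k t : ℕ) = l t := by
    intro t
    have h1 := congrArg ZMod.val (congrFun h t)
    have hlt : ∀ (u : ZMod f) (i : Fin N), N * u.val + (i : ℕ) < N * f := by
      intro u i
      have hu := ZMod.val_lt u
      calc N * u.val + (i : ℕ) < N * u.val + N := by have := i.2; omega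
        _ = N * (u.val + 1) := by ring
        _ ≤ N * f := Nat.mul_le_mul_left _ hu
    simp only [tileCell] at h1
    rw [ZMod.val_natCast_of_lt (hlt _ _), ZMod.val_natCast_of_lt (hlt _ _)] at h1
    have hdiv := congrArg (· / N) h1
    have hmod := congrArg (· % N) h1
    simp only [Nat.mul_add_div (NeZero.pos N), Nat.div_eq_of_lt (k t).2, Nat.div_eq_of_lt (l t).2,
      Nat.mul_add_mod, Nat.mod_eq_of_lt (k t).2, Nat.mod_eq_of_lt (l t).2, add_zero] at hdiv hmod
    exact ⟨hdiv, hmod⟩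
  refine Prod.ext (funext fun t => ZMod.val_injective f (key t).1)
    (funext fun t => Fin.ext (key t).2)

theorem tileCell_bijective : Function.Bijective (tileCell s N f) := by
  rw [Fintype.bijective_iff_injective_and_card]
  refine ⟨tileCell_injective, ?_⟩
  simp [ZMod.card, mul_pow, mul_comm]

/-- Configurations of the cells are configurations of the tiles. -/
def tileEquiv (s N f d : ℕ) [NeZero N] [NeZero f] :
    Config (Torus s (N * f)) d ≃ (Torus s f → TileConfig s N d) where
  toFun c := tileContent c
  invFun A y := A ((Equiv.ofBijective _ (tileCell_bijective (s := s) (N := N) (f := f))).symm y).1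
    ((Equiv.ofBijective _ (tileCell_bijective (s := s) (N := N) (f := f))).symm y).2
  left_inv c := by
    funext y
    exact congrArg c ((Equiv.ofBijective _ (tileCell_bijective (s := s) (N := N)
      (f := f))).apply_symm_apply y)
  right_inv A := by
    funext x k
    have h := (Equiv.ofBijective _ (tileCell_bijective (s := s) (N := N)
      (f := f))).symm_apply_apply (x, k)
    change A ((Equiv.ofBijective _ tileCell_bijective).symm (Equiv.ofBijective _
      (tileCell_bijective (s := s) (N := N) (f := f)) (x, k))).1 _ = _
    have h' : (Equiv.ofBijective _ (tileCell_bijective (s := s) (N := N) (f := f))).symm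
      (fun t => ((N * (x t).val + (k t : ℕ) : ℕ) : ZMod (N * f))) = (x, k) := h
    rw [h, h']

/-- Regrouping of an operator on tiles as an operator on cells. -/
theorem reindex_emb {κ κ' : Type} (g : κ → Torus s f) (g' : κ' → Torus s (N * f))
    (u : (κ' → Fin d) → κ → TileConfig s N d)
    (hg : ∀ p, tileCell s N f p ∈ Set.range g' ↔ p.1 ∈ Set.range g)
    (hu : ∀ c : Config (Torus s (N * f)) d, u (c ∘ g') = tileEquiv s N f d c ∘ g)
    (M : Matrix (κ → TileConfig s N d) (κ → TileConfig s N d) ℂ) :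
    reindexStar (tileEquiv s N f d) (emb g M) = emb g' (M.submatrix u u) := by
  ext c c'
  rw [reindexStar_apply, Matrix.submatrix_apply]
  have hiff : (∀ x ∉ Set.range g, tileEquiv s N f d c x = tileEquiv s N f d c' x) ↔
      ∀ y ∉ Set.range g', c y = c' y := by
    constructor
    · intro h y hy
      obtain ⟨⟨x, k⟩, rfl⟩ := tileCell_bijective.2 y
      exact congrFun (h x fun hx => hy ((hg _).2 hx)) k
    · intro h x hx
      funext k
      exact h _ fun hy => hx ((hg (x, k)).1 hy)
  by_cases h : ∀ x ∉ Set.range g, tileEquiv s N f d c x = tileEquiv s N f d c' x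
  · rw [emb_apply_of h, emb_apply_of (hiff.1 h), Matrix.submatrix_apply, hu, hu]
  · rw [emb_apply_of_not h, emb_apply_of_not fun h' => h (hiff.2 h')]

theorem reindex_cell (x : Torus s f)
    (a : Matrix (TileConfig s N d) (TileConfig s N d) ℂ) :
    reindexStar (tileEquiv s N f d) (cell x a)
      = emb (fun k : Fin s → Fin N => tileCell s N f (x, k)) a := by
  rw [cell, reindex_emb (κ' := Fin s → Fin N) _ (fun k => tileCell s N f (x, k)) (fun c _ => c)]
  · rfl
  · rintro ⟨y, l⟩
    constructor
    · rintro ⟨k, hk⟩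
      exact ⟨(), congrArg Prod.fst (tileCell_injective hk)⟩
    · rintro ⟨_, rfl⟩
      exact ⟨l, rfl⟩
  · intro c
    rfl

theorem reindex_emb_prod {κ : Type} (g : κ → Torus s f)
    (M : Matrix (κ × (Fin s → Fin N) → Fin d) (κ × (Fin s → Fin N) → Fin d) ℂ) :
    reindexStar (tileEquiv s N f d) (emb g (M.submatrix (fun c p => c p.1 p.2)
      (fun c p => c p.1 p.2)))
      = emb (fun p : κ × (Fin s → Fin N) => tileCell s N f (g p.1, p.2)) M := by
  rw [reindex_emb (κ' := κ × (Fin s → Fin N)) _ (fun p => tileCell s N f (g p.1, p.2))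
    (fun c k l => c (k, l))]
  · rfl
  · rintro ⟨y, l⟩
    constructor
    · rintro ⟨p, hp⟩
      exact ⟨p.1, congrArg Prod.fst (tileCell_injective hp)⟩
    · rintro ⟨k, rfl⟩
      exact ⟨(k, l), rfl⟩
  · intro c
    rfl

/-- The cells of the tile at the origin of `ℤ^s`. -/
def tileOrigin {s N : ℕ} (k : Fin s → Fin N) : Lat s := fun t => (k t : ℕ)

/-- The representative of y modulo f differs from y by a multiple of f, and N times this vanishes
modulo N f. -/
theorem tileCell_wrap (y : Lat s) (k : Fin s → Fin N) :
    tileCell s N f (wrap s f y, k) = wrap s (N * f) (tileOrigin k + (N : ℤ) • y) := by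
  funext t
  change ((N * ((y t : ℤ) : ZMod f).val + (k t : ℕ) : ℕ) : ZMod (N * f))
    = ((((k t : ℕ) : ℤ) + (N : ℤ) * y t : ℤ) : ZMod (N * f))
  have h : (((N * ((y t : ℤ) : ZMod f).val + (k t : ℕ) : ℕ) : ℤ) : ZMod (N * f))
    = ((((k t : ℕ) : ℤ) + (N : ℤ) * y t : ℤ) : ZMod (N * f)) := by
    rw [ZMod.intCast_eq_intCast_iff_dvd_sub]
    push_cast
    rw [ZMod.val_intCast]
    refine ⟨y t / f, ?_⟩
    have := Int.emod_add_mul_ediv (y t) f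
    linear_combination (N : ℤ) * (-this)
  rw [← h, Int.cast_natCast]

/-- The tile that contains a cell of `ℤ^s`. -/
def tileIndex (N : ℕ) (z : Lat s) : Lat s := fun t => z t / N

/-- The position of a cell of `ℤ^s` in its tile. -/
def tilePos (N : ℕ) [NeZero N] (z : Lat s) : Fin s → Fin N := fun t =>
  ⟨(z t % N).toNat, by
    have h1 := Int.emod_nonneg (z t) (Int.natCast_ne_zero.2 (NeZero.ne N))
    have h2 := Int.emod_lt_of_pos (z t) (Int.natCast_pos.2 (NeZero.pos N))
    omega⟩

theorem tileOrigin_tilePos (z : Lat s) :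
    tileOrigin (tilePos N z) + (N : ℤ) • tileIndex N z = z := by
  funext t
  change (((z t % N).toNat : ℕ) : ℤ) + (N : ℤ) * (z t / N) = z t
  rw [Int.toNat_of_nonneg (Int.emod_nonneg (z t) (Int.natCast_ne_zero.2 (NeZero.ne N)))]
  exact Int.emod_add_mul_ediv _ _

theorem mem_tile_iff (z y : Lat s) : z ∈ tile N y ↔ tileIndex N z = y := by
  have hN : (0 : ℤ) < N := Int.natCast_pos.2 (NeZero.pos N)
  constructor
  · intro h
    funext t
    obtain ⟨h1, h2⟩ := h t
    change z t / N = y t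
    rw [Int.ediv_eq_iff_of_pos hN]
    constructor <;> nlinarith
  · rintro rfl t
    change (N : ℤ) * (z t / N) ≤ z t ∧ z t < N * (z t / N) + N
    have h1 := Int.emod_nonneg (z t) hN.ne'
    have h2 := Int.emod_lt_of_pos (z t) hN
    have h3 := Int.emod_add_mul_ediv (z t) N
    constructor <;> linarith

theorem tile_zero_eq_range : tile N (0 : Lat s) = Set.range (tileOrigin (s := s) (N := N)) := by
  ext z
  constructor
  · intro h
    refine ⟨tilePos N z, ?_⟩
    have := tileOrigin_tilePos (N := N) z
    rwa [(mem_tile_iff z 0).1 h, smul_zero, add_zero] at this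
  · rintro ⟨k, rfl⟩ t
    have := (k t).2
    simp only [tileOrigin, Pi.zero_apply, mul_zero, zero_add]
    constructor <;> omega

/-- The cells of the tile at the origin, as a finite set. -/
def tileFinset (s N : ℕ) : Finset (Lat s) := Finset.univ.image (tileOrigin (s := s) (N := N))

theorem coe_tileFinset : (tileFinset s N : Set (Lat s)) = tile N 0 := by
  rw [tile_zero_eq_range, tileFinset, Finset.coe_image, Finset.coe_univ, Set.image_univ]

/-- The scheme on tiles, as a finite set. -/
def tileNbhdFinset (s N : ℕ) (𝒩 : Finset (Lat s)) : Finset (Lat s) :=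
  (tileFinset s N + 𝒩).image (tileIndex N)

theorem coe_tileNbhdFinset (𝒩 : Finset (Lat s)) :
    (tileNbhdFinset s N 𝒩 : Set (Lat s)) = tileNbhd N 𝒩 := by
  ext y
  rw [tileNbhdFinset, Finset.coe_image, Finset.coe_add, coe_tileFinset]
  constructor
  · rintro ⟨z, hz, rfl⟩
    exact ⟨z, hz, (mem_tile_iff _ _).2 rfl⟩
  · rintro ⟨z, hz, hy⟩
    exact ⟨z, hz, (mem_tile_iff _ _).1 hy⟩

/-- A wrapped cell determines its position in its tile and the wrapped tile; injectivity on tiles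
then recovers the tile itself. -/
theorem injOn_wrap_of_tiles {𝒩 : Finset (Lat s)}
    (h : Set.InjOn (wrap s f) (tileNbhdFinset s N 𝒩)) :
    Set.InjOn (wrap s (N * f)) ((tileFinset s N : Set (Lat s)) + 𝒩) := by
  intro z hz w hw hzw
  have hmem : ∀ z ∈ (tileFinset s N : Set (Lat s)) + 𝒩,
      tileIndex N z ∈ (tileNbhdFinset s N 𝒩 : Set (Lat s)) := by
    intro z hz
    rw [tileNbhdFinset, Finset.coe_image, Finset.coe_add]
    exact ⟨z, hz, rfl⟩
  have hz' := tileCell_wrap (N := N) (f := f) (tileIndex N z) (tilePos N z)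
  have hw' := tileCell_wrap (N := N) (f := f) (tileIndex N w) (tilePos N w)
  rw [tileOrigin_tilePos] at hz' hw'
  have := tileCell_injective (hz'.trans (hzw.trans hw'.symm))
  have h1 := h (hmem z hz) (hmem w hw) (congrArg Prod.fst this)
  have h2 := congrArg Prod.snd this
  rw [← tileOrigin_tilePos (N := N) z, ← tileOrigin_tilePos (N := N) w, h1]
  simp only at h2
  rw [h2]

end Tiles

/-! ### Coarse-graining of an automaton -/

section Coarse

variable {s N d : ℕ} [NeZero N]

/-- With an empty scheme the rule would embed the noncommutative algebra of d × d matrices in the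
scalars. -/
theorem QCA.nbhd_nonempty (hd : 2 ≤ d) (T : QCA (Lat s) d) : T.nbhd.Nonempty := by
  have : NeZero d := ⟨by omega⟩
  by_contra h
  rw [Finset.not_nonempty_iff_eq_empty] at h
  obtain ⟨ρ, -⟩ := T.exists_rule
  have : IsEmpty {x // x ∈ T.nbhd} := ⟨fun x => by simpa [h] using x.2⟩
  have hcomm : ∀ a b, ρ (a * b) = ρ (b * a) := by
    intro a b
    rw [map_mul, map_mul]
    ext u v
    obtain rfl := Subsingleton.elim u v
    rw [Matrix.mul_apply, Matrix.mul_apply]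
    exact Finset.sum_congr rfl fun w _ => by rw [Subsingleton.elim w u, mul_comm]
  let i : Fin d := ⟨0, by omega⟩
  let j : Fin d := ⟨1, by omega⟩
  have hij : i ≠ j := by simp [i, j]
  have h1 := matrix_hom_injective ρ (hcomm (Matrix.single i j 1) (Matrix.single j i 1))
  rw [Matrix.single_mul_single_same, Matrix.single_mul_single_same] at h1
  have h2 := congrFun (congrFun h1 i) i
  rw [Matrix.single_apply_same, Matrix.single_apply_of_row_ne hij.symm] at h2
  simp at h2

theorem nbhdPow_nonempty {L : Type} [AddCommGroup L] [DecidableEq L] {𝒩 : Finset L}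
    (h : 𝒩.Nonempty) (n : ℕ) : (nbhdPow 𝒩 n).Nonempty := by
  induction n with
  | zero => exact Finset.singleton_nonempty 0
  | succ n ih => exact ih.add h

/-- The action of the powers of all wrapped evolutions on a region is the same. -/
theorem exists_iterate_image [NeZero d] (T : QCA (Lat s) d) (hne : T.nbhd.Nonempty) (n : ℕ)
    (Ω : Finset (Lat s)) (M : Matrix ({x // x ∈ Ω} → Fin d) ({x // x ∈ Ω} → Fin d) ℂ) :
    ∀ Ω', Ω' = Ω + nbhdPow T.nbhd n →
    ∃ M' : Matrix ({x // x ∈ Ω'} → Fin d) ({x // x ∈ Ω'} → Fin d) ℂ,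
      ∀ (m : ℕ) [NeZero m] (Tw : FinQCA (Torus s m) d), IsWrapped T Tw →
        Set.InjOn (wrap s m) (Ω' : Set (Lat s)) →
        Tw.toEquiv^[n] (emb (fun x : {x // x ∈ Ω} => wrap s m x) M)
          = emb (fun x : {x // x ∈ Ω'} => wrap s m x) M' := by
  induction n with
  | zero =>
    rintro Ω' rfl
    have hΩ : Ω + nbhdPow T.nbhd 0 = Ω := by
      change Ω + {0} = Ω
      rw [Finset.singleton_zero, add_zero]
    rw [hΩ]
    exact ⟨M, fun m _ Tw _ _ => rfl⟩
  | succ n ih =>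
    rintro Ω' rfl
    have hΩ : Ω + nbhdPow T.nbhd (n + 1) = Ω + nbhdPow T.nbhd n + T.nbhd := (add_assoc _ _ _).symm
    rw [hΩ]
    obtain ⟨M₁, h₁⟩ := ih _ rfl
    obtain ⟨ρ, hρ⟩ := T.exists_rule
    obtain ⟨M', -, h'⟩ := exists_local_image hne
      (T.toEquiv : quasiLocal (Lat s) d →⋆ₐ[ℂ] quasiLocal (Lat s) d) ρ hρ _ M₁
    refine ⟨M', fun m _ Tw hTw hinj => ?_⟩
    rw [Finset.coe_add] at hinj
    rw [Function.iterate_succ_apply', h₁ m Tw hTw (injOn_of_add_right hinj hne)]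
    exact h' m (Tw.toEquiv : MatAlg (Torus s m) d →⋆ₐ[ℂ] MatAlg (Torus s m) d) (hTw.rule hρ) hinj

/-- The `N`-th power of an automaton, as an automorphism of the algebra of the lattice of tiles. -/
def coarse {f : ℕ} [NeZero f] (Tw : FinQCA (Torus s (N * f)) d) :
    Matrix (Torus s f → TileConfig s N d) (Torus s f → TileConfig s N d) ℂ ≃⋆ₐ[ℂ]
      Matrix (Torus s f → TileConfig s N d) (Torus s f → TileConfig s N d) ℂ :=
  ((reindexStar (tileEquiv s N f d)).trans (iterEquiv Tw.toEquiv N)).trans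
    (reindexStar (tileEquiv s N f d)).symm

theorem reindex_coarse {f : ℕ} [NeZero f] (Tw : FinQCA (Torus s (N * f)) d)
    (A : Matrix (Torus s f → TileConfig s N d) (Torus s f → TileConfig s N d) ℂ) :
    reindexStar (tileEquiv s N f d) (coarse Tw A)
      = Tw.toEquiv^[N] (reindexStar (tileEquiv s N f d) A) := by
  rw [← iterEquiv_apply]
  exact (reindexStar (tileEquiv s N f d)).apply_symm_apply _

theorem iterate_shiftMat {L : Type} [AddCommGroup L] [Fintype L] [DecidableEq L]
    (Q : FinQCA L d) (n : ℕ) (x : L) (A : MatAlg L d) :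
    Q.toEquiv^[n] (shiftMat x A) = shiftMat x (Q.toEquiv^[n] A) := by
  induction n with
  | zero => rfl
  | succ n ih => rw [Function.iterate_succ_apply', Function.iterate_succ_apply', ih, Q.homogeneity]

/-- The coarse-grained automata on all regular wrapped lattices have the same transition rule. -/
theorem exists_coarse_rule (hd : 2 ≤ d) (T : QCA (Lat s) d) :
    ∃ Θ : Matrix (TileConfig s N d) (TileConfig s N d) ℂ →
        Matrix ({n // n ∈ tileNbhdFinset s N (nbhdPow T.nbhd N)} → TileConfig s N d)
          ({n // n ∈ tileNbhdFinset s N (nbhdPow T.nbhd N)} → TileConfig s N d) ℂ,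
      ∀ (f : ℕ) [NeZero f] (Tw : FinQCA (Torus s (N * f)) d), IsWrapped T Tw →
        Set.InjOn (wrap s f) (tileNbhdFinset s N (nbhdPow T.nbhd N)) →
        ∀ x a, coarse Tw (cell x a) = emb
          (fun n : {n // n ∈ tileNbhdFinset s N (nbhdPow T.nbhd N)} => wrap s f n + x) (Θ a) := by
  have : NeZero d := ⟨by omega⟩
  have hne := T.nbhd_nonempty hd
  let Ω : Finset (Lat s) := tileFinset s N
  let P := nbhdPow T.nbhd N
  let i : (Fin s → Fin N) → {x // x ∈ Ω} := fun k =>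
    ⟨tileOrigin k, Finset.mem_image_of_mem _ (Finset.mem_univ k)⟩
  -- The image after N steps of an operator on Λ₀, fixed before any torus is chosen.
  choose M hM using fun a => exists_iterate_image T hne N Ω (emb i a) (Ω + P) rfl
  -- Relabels a cell by its tile and its position in that tile.
  let j : {x // x ∈ Ω + P} → {n // n ∈ tileNbhdFinset s N P} × (Fin s → Fin N) := fun z =>
    (⟨tileIndex N z.1, Finset.mem_image_of_mem _ z.2⟩, tilePos N z.1)
  refine ⟨fun a => (emb j (M a)).submatrix (fun c p => c p.1 p.2) (fun c p => c p.1 p.2), ?_⟩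
  intro f _ Tw hTw hinj x a
  have hinjP : Set.InjOn (wrap s (N * f)) ((Ω + P : Finset (Lat s)) : Set (Lat s)) := by
    rw [Finset.coe_add]
    exact injOn_wrap_of_tiles hinj
  have hinjΩ : Function.Injective (fun z : {z // z ∈ Ω} => wrap s (N * f) z) := fun u v huv =>
    Subtype.ext (injOn_of_add_right (by rwa [Finset.coe_add] at hinjP)
      (Finset.coe_nonempty.2 (nbhdPow_nonempty hne N)) u.2 v.2 huv)
  obtain ⟨y, rfl⟩ := wrap_surjective s f x
  refine EquivLike.injective (reindexStar (tileEquiv s N f d)) ?_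
  rw [reindex_coarse, reindex_cell, reindex_emb_prod]
  -- The tile y is the translate of Λ₀ by N y, so homogeneity reduces the claim to Λ₀.
  have h1 : emb (fun k : Fin s → Fin N => tileCell s N f (wrap s f y, k)) a
      = shiftMat (wrap s (N * f) ((N : ℤ) • y))
        (emb (fun z : {z // z ∈ Ω} => wrap s (N * f) z) (emb i a)) := by
    rw [← emb_comp hinjΩ, shiftMat, emb_shift]
    congr 1
    funext k
    rw [tileCell_wrap, map_add]
    rfl
  rw [h1, iterate_shiftMat, hM a (N * f) Tw hTw hinjP, shiftMat, emb_shift, ← emb_comp]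
  · congr 1
    funext z
    have h2 : wrap s f (j z).1 + wrap s f y = wrap s f (tileIndex N z.1 + y) :=
      (map_add _ _ _).symm
    simp only [Function.comp_apply]
    rw [h2, tileCell_wrap, smul_add, ← add_assoc, map_add]
    congr 2
    exact (tileOrigin_tilePos z.1).symm
  · intro p q hpq
    have := tileCell_injective hpq
    refine Prod.ext (Subtype.ext (hinj p.1.2 q.1.2 ?_)) (Prod.mk.inj this).2
    exact add_right_cancel (Prod.mk.inj this).1

end Coarse

/-! ### Automorphisms of matrix algebras -/

section MatrixAut

variable {n m : Type} [Fintype n] [DecidableEq n] [Fintype m] [DecidableEq m]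

/-- A `*`-automorphism of a matrix algebra is implemented by a unitary. -/
theorem exists_unitary_of_starAlgEquiv (Φ : Matrix n n ℂ ≃⋆ₐ[ℂ] Matrix n n ℂ) :
    ∃ U ∈ Matrix.unitaryGroup n ℂ, ∀ A, Φ A = Uᴴ * A * U := by
  let E : Matrix n n ℂ ≃⋆ₐ[ℂ] _ := Matrix.toEuclideanCLM (n := n) (𝕜 := ℂ)
  let F := (E.symm.trans Φ).trans E
  have hF : Continuous F := LinearMap.continuous_of_finiteDimensional F.toAlgEquiv.toLinearMap
  obtain ⟨W, hW⟩ := F.eq_linearIsometryEquivConjStarAlgEquiv hF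
  let u := Unitary.linearIsometryEquiv.symm W
  have hu : Unitary.linearIsometryEquiv u = W := Unitary.linearIsometryEquiv.apply_symm_apply W
  have hFu : ∀ x, F x = u.1 * x * star u.1 := by
    intro x
    rw [hW, ← hu, Unitary.conjStarAlgEquiv_unitaryLinearIsometryEquiv,
      Unitary.conjStarAlgAut_apply]
  let V : Matrix n n ℂ := E.symm u.1
  have hV : E V = u.1 := E.apply_symm_apply u.1
  -- The adjoint appears because conjugation by V reads V A V†, while U† A U is wanted.
  refine ⟨star V, ?_, fun A => EquivLike.injective E ?_⟩
  · rw [Matrix.mem_unitaryGroup_iff, star_star]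
    refine EquivLike.injective E ?_
    rw [map_mul E, map_star E, hV, map_one E]
    exact Unitary.coe_star_mul_self u
  · have h1 : F (E A) = E (Φ A) := congrArg (fun B => E (Φ B)) (E.symm_apply_apply A)
    rw [← h1, hFu, ← Matrix.star_eq_conjTranspose, star_star, map_mul E, map_mul E, map_star E, hV]

open scoped ComplexOrder in
/-- A projection below its image under an automorphism is equal to it. -/
theorem starAlgEquiv_fixes_projection (Φ : Matrix n n ℂ ≃⋆ₐ[ℂ] Matrix n n ℂ) {P : Matrix n n ℂ}
    (hP : IsStarProjection P) (h : Φ P * P = P) : Φ P = P := by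
  have h1 : P * Φ P = P := by
    have := congrArg star h
    rwa [star_mul, ← map_star, hP.isSelfAdjoint.star_eq] at this
  have h2 : Φ P * Φ P = Φ P := by rw [← map_mul, hP.isIdempotentElem.eq]
  have hstar : (Φ P - P)ᴴ = Φ P - P := by
    rw [← Matrix.star_eq_conjTranspose, star_sub, ← map_star, hP.isSelfAdjoint.star_eq]
  -- The difference is a projection; automorphisms preserve the trace, so its trace is zero and it
  -- vanishes.
  have h3 : (Φ P - P)ᴴ * (Φ P - P) = Φ P - P := by
    rw [hstar, sub_mul, mul_sub, mul_sub, h1, h2, h, hP.isIdempotentElem.eq]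
    abel
  have h4 : Matrix.trace ((Φ P - P)ᴴ * (Φ P - P)) = 0 := by
    rw [h3, Matrix.trace_sub, Matrix.trace_map, sub_self]
  exact sub_eq_zero.1 (Matrix.trace_conjTranspose_mul_self_eq_zero_iff.1 h4)

/-- An automorphism that fixes the projection `J† J` induces one of the compressed algebra. -/
theorem exists_compressed_equiv (G : Matrix n n ℂ ≃⋆ₐ[ℂ] Matrix n n ℂ) (J : Matrix m n ℂ)
    (hJ : J * Jᴴ = 1) (hG : G (Jᴴ * J) = Jᴴ * J) :
    ∃ S : Matrix m m ℂ ≃⋆ₐ[ℂ] Matrix m m ℂ, ∀ A : Matrix m m ℂ, S A = J * G (Jᴴ * A * J) * Jᴴ ∧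
      Jᴴ * S A * J = G (Jᴴ * A * J) := by
  -- An automorphism fixing J†J preserves its corner, on which compressing and embedding again loses
  -- nothing. `G` is quantified anew because the inverse needs the same fact.
  have absorb : ∀ (G : Matrix n n ℂ ≃⋆ₐ[ℂ] Matrix n n ℂ), G (Jᴴ * J) = Jᴴ * J → ∀ A : Matrix m m ℂ,
      Jᴴ * (J * G (Jᴴ * A * J) * Jᴴ) * J = G (Jᴴ * A * J) := by
    intro G hG A
    calc Jᴴ * (J * G (Jᴴ * A * J) * Jᴴ) * J = (Jᴴ * J) * G (Jᴴ * A * J) * (Jᴴ * J) := by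
          simp only [Matrix.mul_assoc]
      _ = G ((Jᴴ * J) * (Jᴴ * A * J) * (Jᴴ * J)) := by rw [map_mul, map_mul, hG]
      _ = G (Jᴴ * (J * Jᴴ) * A * (J * Jᴴ) * J) := by simp only [Matrix.mul_assoc]
      _ = G (Jᴴ * A * J) := by rw [hJ, Matrix.mul_one, Matrix.mul_one]
  have cancel : ∀ A : Matrix m m ℂ, J * (Jᴴ * A * J) * Jᴴ = A := by
    intro A
    calc J * (Jᴴ * A * J) * Jᴴ = (J * Jᴴ) * A * (J * Jᴴ) := by simp only [Matrix.mul_assoc]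
      _ = A := by rw [hJ, Matrix.one_mul, Matrix.mul_one]
  have hGs : G.symm (Jᴴ * J) = Jᴴ * J := by
    rw [← hG, StarAlgEquiv.symm_apply_apply, hG]
  refine ⟨{ toFun := fun A => J * G (Jᴴ * A * J) * Jᴴ
            invFun := fun A => J * G.symm (Jᴴ * A * J) * Jᴴ
            left_inv := fun A => ?_
            right_inv := fun A => ?_
            map_mul' := fun A B => ?_
            map_add' := fun A B => ?_
            map_smul' := fun z A => ?_
            map_star' := fun A => ?_ }, fun A => ⟨rfl, absorb G hG A⟩⟩
  · simp only [absorb G hG, StarAlgEquiv.symm_apply_apply, cancel]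
  · simp only [absorb G.symm hGs, StarAlgEquiv.apply_symm_apply, cancel]
  · calc J * G (Jᴴ * (A * B) * J) * Jᴴ
        = J * G (Jᴴ * A * (J * Jᴴ) * B * J) * Jᴴ := by
          rw [hJ, Matrix.mul_one]; simp only [Matrix.mul_assoc]
      _ = J * (G (Jᴴ * A * J) * G (Jᴴ * B * J)) * Jᴴ := by
          rw [← map_mul]; simp only [Matrix.mul_assoc]
      _ = J * (G (Jᴴ * A * J) * (Jᴴ * (J * G (Jᴴ * B * J) * Jᴴ) * J)) * Jᴴ := by
          rw [absorb G hG]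
      _ = J * G (Jᴴ * A * J) * Jᴴ * (J * G (Jᴴ * B * J) * Jᴴ) * (J * Jᴴ) := by
          simp only [Matrix.mul_assoc]
      _ = _ := by rw [hJ, Matrix.mul_one]
  · rw [Matrix.mul_add, Matrix.add_mul, map_add, Matrix.mul_add, Matrix.add_mul]
  · simp only [Matrix.star_eq_conjTranspose, Matrix.conjTranspose_mul,
      Matrix.conjTranspose_conjTranspose]
    rw [← Matrix.star_eq_conjTranspose (G _), ← map_star, Matrix.star_eq_conjTranspose]
    simp only [Matrix.conjTranspose_mul, Matrix.conjTranspose_conjTranspose, Matrix.mul_assoc]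
  · simp only [Matrix.mul_smul, Matrix.smul_mul, map_smul]

end MatrixAut

/-! ### Compression by a product isometry -/

section Compression

variable {α β κ L : Type} [Fintype α] [DecidableEq α] [Fintype β] [DecidableEq β] [Fintype κ]
  [DecidableEq κ] [Fintype L] [DecidableEq L]

theorem tens_mul_conjTranspose {J : Matrix β α ℂ} (hJ : J * Jᴴ = 1) :
    tens (fun _ : L => J) * (tens fun _ : L => J)ᴴ = 1 := by
  rw [tens_conjTranspose, tens_mul, hJ, tens_one]

theorem tens_conjTranspose_mul (J : Matrix β α ℂ) :
    (tens fun _ : L => J)ᴴ * tens (fun _ : L => J) = tens fun _ : L => Jᴴ * J := by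
  rw [tens_conjTranspose, tens_mul]

/-- Off the range of `g` each factor contributes J J† = 1, so compression does not enlarge the
support. -/
theorem tens_mul_emb_mul_tens {g : κ → L} (hg : g.Injective) {J : Matrix β α ℂ}
    (hJ : J * Jᴴ = 1) (X : Matrix (κ → α) (κ → α) ℂ) :
    tens (fun _ : L => J) * emb g X * (tens fun _ : L => J)ᴴ
      = emb g (tens (fun _ : κ => J) * X * (tens fun _ : κ => J)ᴴ) := by
  induction X using tens_induction with
  | htens a =>
    rw [emb_tens hg, tens_conjTranspose, tens_conjTranspose, tens_mul, tens_mul, tens_mul, tens_mul,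
      emb_tens hg]
    congr 1
    funext x
    by_cases hx : x ∈ Set.range g
    · obtain ⟨k, rfl⟩ := hx
      rw [hg.extend_apply, hg.extend_apply]
    · rw [extend_notMem_range _ _ _ hx, extend_notMem_range _ _ _ hx, Pi.one_apply, Matrix.mul_one,
        hJ, Pi.one_apply]
  | hadd A B hA hB =>
    rw [emb_add, Matrix.mul_add, Matrix.add_mul, hA, hB, Matrix.mul_add, Matrix.add_mul, emb_add]
  | hsmul z A hA =>
    rw [emb_smul, Matrix.mul_smul, Matrix.smul_mul, hA, Matrix.mul_smul, Matrix.smul_mul, emb_smul]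

/-- An embedded one-cell operator is not local, since J†J sits on all other cells. This splits it
into a local factor and the global projection, which the automorphism fixes. -/
theorem conj_cell_tens {J : Matrix β α ℂ} (hJ : J * Jᴴ = 1) (x : L) (a : Matrix β β ℂ) :
    (tens fun _ : L => J)ᴴ * cell x a * tens (fun _ : L => J)
      = cell x (Jᴴ * a * J) * tens fun _ : L => Jᴴ * J := by
  rw [Matrix.mul_assoc, cell_mul_tens, cell_mul_tens, tens_conjTranspose, tens_mul]
  congr 1
  funext y
  by_cases hy : y = x
  · subst hy
    rw [Function.update_self, Function.update_self]
    calc Jᴴ * (a * J) = Jᴴ * a * (1 : Matrix β β ℂ) * J := by rw [Matrix.mul_one, Matrix.mul_assoc]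
      _ = Jᴴ * a * J * (Jᴴ * J) := by rw [← hJ]; simp only [Matrix.mul_assoc]
  · rw [Function.update_of_ne hy, Function.update_of_ne hy]

/-- The transition rule of the compressed automorphism. -/
theorem compressed_rule {g : κ → L} (hg : g.Injective) {J : Matrix β α ℂ} (hJ : J * Jᴴ = 1)
    (G : Matrix (L → α) (L → α) ℂ ≃⋆ₐ[ℂ] Matrix (L → α) (L → α) ℂ)
    (hG : G (tens fun _ => Jᴴ * J) = tens fun _ => Jᴴ * J) {x : L} {a : Matrix β β ℂ}
    {X : Matrix (κ → α) (κ → α) ℂ} (hX : G (cell x (Jᴴ * a * J)) = emb g X) :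
    tens (fun _ : L => J) * G ((tens fun _ : L => J)ᴴ * cell x a * tens fun _ : L => J)
        * (tens fun _ : L => J)ᴴ
      = emb g (tens (fun _ : κ => J) * X * (tens fun _ : κ => J)ᴴ) := by
  rw [conj_cell_tens hJ, map_mul, hG, hX, ← tens_mul_emb_mul_tens hg hJ, ← tens_conjTranspose_mul]
  have h := tens_mul_conjTranspose (L := L) hJ
  calc tens (fun _ : L => J) * (emb g X * ((tens fun _ : L => J)ᴴ * tens fun _ : L => J))
        * (tens fun _ : L => J)ᴴ
      = tens (fun _ : L => J) * emb g X * (tens fun _ : L => J)ᴴ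
        * (tens (fun _ : L => J) * (tens fun _ : L => J)ᴴ) := by simp only [Matrix.mul_assoc]
    _ = _ := by rw [h, Matrix.mul_one]

/-- Whether a local operator acts trivially on the range of a product of projections can be
decided locally. -/
theorem emb_mul_tens_eq_iff {g : κ → L} (hg : g.Injective) {p : Matrix α α ℂ} (hp : p ≠ 0)
    (X : Matrix (κ → α) (κ → α) ℂ) :
    emb g X * tens (fun _ : L => p) = tens (fun _ : L => p) ↔
      X * tens (fun _ : κ => p) = tens fun _ : κ => p := by
  have hsplit : ∀ F : L → ℂ, ∏ x, F x = (∏ k, F (g k)) * ∏ x ∈ (Finset.univ.image g)ᶜ, F x := by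
    intro F
    rw [← Finset.prod_mul_prod_compl (Finset.univ.image g), Finset.prod_image hg.injOn]
  have hoff : ∀ (b : κ → α) (c c' : L → α), ∏ x ∈ (Finset.univ.image g)ᶜ,
      p (Function.extend g b c x) (c' x) = ∏ x ∈ (Finset.univ.image g)ᶜ, p (c x) (c' x) := by
    intro b c c'
    refine Finset.prod_congr rfl fun x hx => ?_
    rw [extend_notMem_range]
    simpa using hx
  -- On both sides an entry is the entry on `κ` times the same product of entries of p outside.
  have hleft : ∀ c c', (emb g X * tens (fun _ : L => p)) c c'
      = (X * tens (fun _ : κ => p)) (c ∘ g) (c' ∘ g)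
        * ∏ x ∈ (Finset.univ.image g)ᶜ, p (c x) (c' x) := by
    intro c c'
    rw [emb_mul_apply hg, Matrix.mul_apply, Finset.sum_mul]
    refine Finset.sum_congr rfl fun b _ => ?_
    rw [tens_apply, hsplit, hoff, tens_apply, mul_assoc]
    simp only [hg.extend_apply, Function.comp_apply]
  have hright : ∀ c c', tens (fun _ : L => p) c c'
      = tens (fun _ : κ => p) (c ∘ g) (c' ∘ g)
        * ∏ x ∈ (Finset.univ.image g)ᶜ, p (c x) (c' x) := by
    intro c c'
    rw [tens_apply, hsplit, tens_apply]
    simp only [Function.comp_apply]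
  constructor
  · intro h
    -- Constant outer configurations u and v make the outer product a power of a nonzero entry,
    -- which can be cancelled.
    obtain ⟨u, v, huv⟩ : ∃ u v, p u v ≠ 0 := by
      by_contra! h'
      exact hp (Matrix.ext h')
    ext a b
    have := congrFun (congrFun h (Function.extend g a fun _ => u)) (Function.extend g b fun _ => v)
    rw [hleft, hright, Function.extend_comp hg, Function.extend_comp hg] at this
    refine mul_right_cancel₀ ?_ this
    refine Finset.prod_ne_zero_iff.2 fun x hx => ?_
    have hx' : x ∉ Set.range g := by simpa using hx
    rwa [extend_notMem_range _ _ _ hx', extend_notMem_range _ _ _ hx']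
  · intro h
    ext c c'
    rw [hleft, hright, h]

/-- If the image of each factor acts trivially on the range of a product of projections, then the
product is fixed. -/
theorem fixes_tens_of_cells (G : Matrix (L → α) (L → α) ℂ ≃⋆ₐ[ℂ] Matrix (L → α) (L → α) ℂ)
    {p : Matrix α α ℂ} (hp : IsStarProjection p)
    (h : ∀ x, G (cell x p) * tens (fun _ : L => p) = tens fun _ : L => p) :
    G (tens fun _ : L => p) = tens fun _ : L => p := by
  have hproj : IsStarProjection (tens fun _ : L => p) := by
    constructor
    · rw [IsIdempotentElem, tens_mul, hp.isIdempotentElem.eq]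
    · rw [IsSelfAdjoint, Matrix.star_eq_conjTranspose, tens_conjTranspose,
        ← Matrix.star_eq_conjTranspose, hp.isSelfAdjoint.star_eq]
  refine starAlgEquiv_fixes_projection G hproj ?_
  -- The factors are absorbed one by one; for Ω the whole lattice this says that the product lies
  -- below its image.
  have key : ∀ Ω : Finset L, G (tens fun x => if x ∈ Ω then p else 1) * tens (fun _ : L => p)
      = tens fun _ : L => p := by
    intro Ω
    induction Ω using Finset.induction_on with
    | empty => simp [tens_one]
    | insert x Ω hx ih =>
      have : (tens fun y => if y ∈ insert x Ω then p else 1)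
          = cell x p * tens fun y => if y ∈ Ω then p else 1 := by
        rw [cell_mul_tens]
        congr 1
        funext y
        by_cases hy : y = x
        · subst hy; simp [hx]
        · simp [hy]
      rw [this, map_mul, mul_assoc, ih, h]
  simpa using key Finset.univ

end Compression

/-! ### Unwrapping -/

section Shift

variable {L : Type} [AddCommGroup L] [DecidableEq L] {d : ℕ}

theorem shift_add (x : L) (a b : quasiLocal L d) : shift x (a + b) = shift x a + shift x b :=
  Subtype.ext <| by
    change shiftOp x * (a.1 + b.1) * shiftOp (-x) = _
    rw [mul_add, add_mul]
    rfl

theorem shift_mul (x : L) (a b : quasiLocal L d) : shift x (a * b) = shift x a * shift x b :=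
  Subtype.ext <| by
    change shiftOp x * (a.1 * b.1) * shiftOp (-x)
      = shiftOp x * a.1 * shiftOp (-x) * (shiftOp x * b.1 * shiftOp (-x))
    simp only [mul_assoc]
    rw [← mul_assoc (shiftOp (-x)) (shiftOp x), shiftOp_mul_neg, one_mul]

theorem shift_smul (x : L) (z : ℂ) (a : quasiLocal L d) : shift x (z • a) = z • shift x a :=
  Subtype.ext <| by
    change shiftOp x * (z • a.1) * shiftOp (-x) = z • (shiftOp x * a.1 * shiftOp (-x))
    rw [mul_smul_comm, smul_mul_assoc]

theorem shift_one (x : L) : shift x (1 : quasiLocal L d) = 1 :=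
  Subtype.ext <| by
    change shiftOp x * 1 * shiftOp (-x) = 1
    have h := shiftOp_mul_neg (d := d) (-x)
    rw [neg_neg] at h
    rw [mul_one, h]

theorem continuous_shift (x : L) : Continuous (shift (d := d) x) :=
  Continuous.subtype_mk (by fun_prop) _

end Shift

/-! ### Lifting a transition rule from one torus to ℤ^s. -/

section Unwrap

variable {s d : ℕ} [NeZero d] {P : Finset (Lat s)}

/-- A homomorphism with a transition rule commutes with the shifts. -/
theorem map_shift_of_rule (F : quasiLocal (Lat s) d →⋆ₐ[ℂ] quasiLocal (Lat s) d)
    (hFc : Continuous F)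
    (θ : Matrix (Fin d) (Fin d) ℂ → Matrix ({n // n ∈ P} → Fin d) ({n // n ∈ P} → Fin d) ℂ)
    (hF : ∀ x a, F (cellOp x a) = qHom (shiftEmb (regionEmb P) x) (θ a)) (x : Lat s)
    (a : quasiLocal (Lat s) d) : F (shift x a) = shift x (F a) := by
  refine quasiLocal_induction (P := fun a => F (shift x a) = shift x (F a))
    (isClosed_eq (hFc.comp (continuous_shift x)) ((continuous_shift x).comp hFc)) (fun Ω M => ?_) a
  rw [regionOp_eq_qHom]
  induction M using cell_induction with
  | hone => rw [map_one, shift_one, map_one, shift_one]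
  | hcell y a =>
    rw [qHom_cell, shift_cellOp, hF, hF, shift_qHom]
    congr 2
    exact Function.Embedding.ext fun n => (add_assoc _ _ _).symm
  | hadd A B hA hB => rw [map_add, shift_add, map_add, hA, hB, map_add, shift_add]
  | hmul A B hA hB => rw [map_mul, shift_mul, map_mul, hA, hB, map_mul, shift_mul]
  | hsmul z A hA => rw [map_smul, shift_smul, map_smul, hA, map_smul, shift_smul]

/-- If an automorphism on a wrapped lattice has a transition rule with a regular scheme, then each
cell is in the range of the homomorphism with the same rule on the infinite lattice. -/
theorem cellOp_mem_range {m : ℕ} [NeZero m] (hP : P.Nonempty)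
    (hdiff : DiffInj (wrap s m) (P : Set (Lat s)))
    (Fw : MatAlg (Torus s m) d ≃⋆ₐ[ℂ] MatAlg (Torus s m) d)
    (F : quasiLocal (Lat s) d →⋆ₐ[ℂ] quasiLocal (Lat s) d)
    (θ : Matrix (Fin d) (Fin d) ℂ → Matrix ({n // n ∈ P} → Fin d) ({n // n ∈ P} → Fin d) ℂ)
    (hFw : ∀ x a, Fw (cell x a) = emb (fun n : {n // n ∈ P} => wrap s m n + x) (θ a))
    (hF : ∀ x a, F (cellOp x a) = qHom (shiftEmb (regionEmb P) x) (θ a))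
    (x : Lat s) (a : Matrix (Fin d) (Fin d) ℂ) : ∃ b, F b = cellOp x a := by
  have hinj : ∀ x : Torus s m,
      Function.Injective fun n : {n // n ∈ P} => wrap s m n + x := fun x u v h =>
    Subtype.ext (hdiff.injOn u.2 v.2 (add_right_cancel h))
  -- The cells whose neighbourhood contains x. Their neighbourhoods stay in x + (P − P), which is
  -- wrapped injectively.
  let Ω : Finset (Lat s) := P.image (fun n => x - n)
  have hΩ : ∀ z ∈ (Ω : Set (Lat s)) + P, z - x ∈ (P : Set (Lat s)) - P := by
    rintro _ ⟨_, hu, v, hv, rfl⟩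
    obtain ⟨u, hu', rfl⟩ := Finset.mem_image.1 (Finset.mem_coe.1 hu)
    refine ⟨v, hv, u, hu', ?_⟩
    change v - u = x - u + v - x
    abel
  have hinjΩ : Set.InjOn (wrap s m) ((Ω : Set (Lat s)) + P) := by
    intro u hu v hv huv
    have := hdiff.injOn_sub (hΩ u hu) (hΩ v hv) (by rw [map_sub, map_sub, huv])
    exact sub_left_injective this
  have hinjΩ' : Function.Injective fun z : {z // z ∈ Ω} => wrap s m z := fun u v h =>
    Subtype.ext (injOn_of_add_right hinjΩ (Finset.coe_nonempty.2 hP) u.2 v.2 h)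
  have hinjΩP : Function.Injective fun z : {z // z ∈ Ω + P} => wrap s m z := fun u v h =>
    Subtype.ext (hinjΩ (by rw [← Finset.coe_add]; exact u.2) (by rw [← Finset.coe_add]; exact v.2) h)
  -- If the neighbourhood of y misses x, the image of any operator on y commutes with the operators
  -- on x. Applying the inverse, the preimage commutes with all cells outside Ω and hence lives on
  -- Ω.
  obtain ⟨M, hM⟩ := exists_emb_of_commute hinjΩ' (Fw.symm (cell (wrap s m x) a)) (by
    intro y hy b
    have h1 : Commute (cell (wrap s m x) a) (Fw (cell y b)) := by
      rw [hFw]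
      refine emb_commute_of_disjoint (fun _ _ _ => rfl) (hinj y) (fun _ n h => ?_) _ _
      refine hy ⟨⟨x - n, Finset.mem_image_of_mem _ n.2⟩, ?_⟩
      change wrap s m (x - n) = y
      rw [map_sub, h, add_sub_cancel_left]
    have h2 := h1.map Fw.symm
    rwa [StarAlgEquiv.symm_apply_apply] at h2)
  obtain ⟨M', hM', hM''⟩ := exists_local_image hP F θ hF Ω M
  refine ⟨regionOp Ω M, hM'.trans ?_⟩
  have h3 := hM'' m (Fw : MatAlg (Torus s m) d →⋆ₐ[ℂ] MatAlg (Torus s m) d) hFw hinjΩ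
  rw [← hM] at h3
  have hx : x ∈ Ω + P := by
    obtain ⟨n, hn⟩ := hP
    have := Finset.add_mem_add (Finset.mem_image_of_mem (fun n => x - n) hn) hn
    rwa [sub_add_cancel] at this
  have h4 : cell (wrap s m x) a = emb (fun z : {z // z ∈ Ω + P} => wrap s m z) M' :=
    (Fw.apply_symm_apply _).symm.trans h3
  have h5 : M' = cell ⟨x, hx⟩ a := by
    refine emb_injective hinjΩP ?_
    rw [← h4, emb_cell hinjΩP]
  rw [h5, regionOp_eq_qHom, qHom_cell]
  rfl

/-- A transition rule that defines an automorphism on one wrapped lattice over which the scheme is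
regular defines an automaton on the infinite lattice. -/
theorem exists_unwrapped {m : ℕ} [NeZero m] (hP : P.Nonempty)
    (hdiff : DiffInj (wrap s m) (P : Set (Lat s)))
    (Fw : MatAlg (Torus s m) d ≃⋆ₐ[ℂ] MatAlg (Torus s m) d)
    (θ : Matrix (Fin d) (Fin d) ℂ → Matrix ({n // n ∈ P} → Fin d) ({n // n ∈ P} → Fin d) ℂ)
    (hFw : ∀ x a, Fw (cell x a) = emb (fun n : {n // n ∈ P} => wrap s m n + x) (θ a)) :
    ∃ S : QCA (Lat s) d, ∀ (f : ℕ) [NeZero f] (Sw : FinQCA (Torus s f) d),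
      IsRegular (wrap s f) (P : Set (Lat s)) → Sw.nbhd = P.image (wrap s f) →
      (∀ a, Sw.toEquiv (cell 0 a) = emb (fun n : {n // n ∈ P} => wrap s f n) (θ a)) →
      IsWrapped S Sw := by
  have hinj : ∀ x : Torus s m,
      Function.Injective fun n : {n // n ∈ P} => wrap s m n + x := fun x u v h =>
    Subtype.ext (hdiff.injOn u.2 v.2 (add_right_cancel h))
  -- The rule is given as a mere function; being the restriction of an automorphism to one cell, it
  -- is a homomorphism.
  obtain ⟨θ', hθ'⟩ := exists_hom_lift ((Fw : MatAlg (Torus s m) d →⋆ₐ[ℂ] MatAlg (Torus s m) d).comp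
    (cellHom 0)) (embHom (hinj 0)) (emb_injective (hinj 0)) (fun a => ⟨θ a, (hFw 0 a).symm⟩)
  have hθ : ∀ a, θ' a = θ a := fun a => emb_injective (hinj 0) ((hθ' a).trans (hFw 0 a))
  obtain ⟨F, hFi, hF'⟩ := exists_quasiLocal_hom
    (fun x : Lat s => (qHom (shiftEmb (regionEmb P) x)).comp θ') (by
      intro x y hne a b
      simp only [StarAlgHom.comp_apply, hθ]
      by_cases hd : ∀ k l : {n // n ∈ P}, (k : Lat s) + x ≠ l + y
      · exact qHom_commute_of_disjoint _ _ hd _ _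
      · push Not at hd
        obtain ⟨k, l, hkl⟩ := hd
        rw [commute_wrap_iff (hdiff.injOn_union k.2 l.2 hkl), ← hFw, ← hFw]
        refine (cell_commute (fun hxy => hne ?_) a b).map Fw
        -- Distinct cells with meeting neighbourhoods stay distinct after wrapping, because x − y
        -- and 0 are both in P − P.
        have h1 : x - y ∈ (P : Set (Lat s)) - P := ⟨l, l.2, k, k.2, by
          change (l : Lat s) - k = x - y
          rw [sub_eq_sub_iff_add_eq_add, add_comm x, hkl]⟩
        have h2 : (0 : Lat s) ∈ (P : Set (Lat s)) - P := ⟨k, k.2, k, k.2, sub_self _⟩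
        exact sub_eq_zero.1 (hdiff.injOn_sub h1 h2 (by rw [map_sub, hxy, sub_self, map_zero])))
  have hF : ∀ x a, F (cellOp x a) = qHom (shiftEmb (regionEmb P) x) (θ a) := fun x a => by
    rw [hF', StarAlgHom.comp_apply, hθ]
  -- An isometry of a complete space has closed range, so it suffices to reach local operators, and
  -- these are generated by cells.
  have hsurj : Function.Surjective F := by
    refine quasiLocal_induction (P := fun a => ∃ b, F b = a) hFi.isClosedEmbedding.isClosed_range
      (fun Ω M => ?_)
    rw [regionOp_eq_qHom]
    induction M using cell_induction with
    | hone => exact ⟨1, by rw [map_one, map_one]⟩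
    | hcell x a =>
      rw [qHom_cell]
      exact cellOp_mem_range hP hdiff Fw F θ hFw hF _ a
    | hadd A B hA hB =>
      obtain ⟨u, hu⟩ := hA
      obtain ⟨v, hv⟩ := hB
      exact ⟨u + v, by rw [map_add, map_add, hu, hv]⟩
    | hmul A B hA hB =>
      obtain ⟨u, hu⟩ := hA
      obtain ⟨v, hv⟩ := hB
      exact ⟨u * v, by rw [map_mul, map_mul, hu, hv]⟩
    | hsmul z A hA =>
      obtain ⟨u, hu⟩ := hA
      exact ⟨z • u, by rw [map_smul, map_smul, hu]⟩
  let S : QCA (Lat s) d :=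
    { toEquiv := StarAlgEquiv.ofBijective F ⟨hFi.injective, hsurj⟩
      nbhd := P
      locality := by
        rintro Ω a ⟨M, hM⟩
        obtain ⟨M', hM', -⟩ := exists_local_image hP F θ hF Ω M
        have ha : a = regionOp Ω M := Subtype.ext hM.symm
        rw [ha]
        exact ⟨M', (congrArg Subtype.val hM').symm⟩
      homogeneity := map_shift_of_rule F hFi.continuous θ hF }
  refine ⟨S, fun f _ Sw hreg hn hrule => ⟨hreg, hn, fun a => ⟨θ a, ?_, hrule a⟩⟩⟩
  refine (hF 0 a).trans ?_
  rw [shiftEmb_zero]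
  rfl

end Unwrap

/-! ### Renormalisation -/

section Regularity

variable {s : ℕ}

/-- A finite scheme is regular over all large wrapped lattices. -/
theorem exists_diffInj_wrap (𝒩 : Finset (Lat s)) :
    ∃ B : ℕ, ∀ m : ℕ, B < m → DiffInj (wrap s m) (𝒩 : Set (Lat s)) := by
  let b : ℕ := ∑ n ∈ 𝒩, ∑ t, (n t).natAbs
  have hb : ∀ n ∈ 𝒩, ∀ t, (n t).natAbs ≤ b := fun n hn t =>
    (Finset.single_le_sum (f := fun t => (n t).natAbs) (fun _ _ => Nat.zero_le _)
      (Finset.mem_univ t)).trans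
      (Finset.single_le_sum (f := fun n : Lat s => ∑ t, (n t).natAbs)
        (fun _ _ => Nat.zero_le _) hn)
  -- Each coordinate of the alternating sum of four elements is at most 4b in absolute value, so if
  -- m > 4b divides it, it is zero.
  refine ⟨4 * b, fun m hm n₁ h₁ n₂ h₂ n₃ h₃ n₄ h₄ h0 => funext fun t => ?_⟩
  have h1 : ((n₁ - n₂ + n₃ - n₄) t : ZMod m) = 0 := congrFun h0 t
  rw [ZMod.intCast_zmod_eq_zero_iff_dvd] at h1
  refine Int.eq_zero_of_abs_lt_dvd h1 ?_
  have := hb n₁ h₁ t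
  have := hb n₂ h₂ t
  have := hb n₃ h₃ t
  have := hb n₄ h₄ t
  simp only [Pi.sub_apply, Pi.add_apply]
  rw [abs_lt]
  omega

theorem tileNbhdFinset_nonempty {N : ℕ} [NeZero N] {𝒩 : Finset (Lat s)} (h : 𝒩.Nonempty) :
    (tileNbhdFinset s N 𝒩).Nonempty :=
  (Finset.Nonempty.add (Finset.univ_nonempty.image _) h).image _

theorem exists_powRegular {d N : ℕ} [NeZero N] (T : QCA (Lat s) d) :
    ∃ (f : ℕ) (_ : NeZero f), PowRegular T N f := by
  obtain ⟨B₁, h₁⟩ := exists_diffInj_wrap (nbhdPow T.nbhd N)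
  obtain ⟨B₂, h₂⟩ := exists_diffInj_wrap (tileNbhdFinset s N (nbhdPow T.nbhd N))
  refine ⟨B₁ + B₂ + 1, ⟨by omega⟩, (h₁ _ ?_).isRegular, ?_⟩
  · have := Nat.le_mul_of_pos_left (B₁ + B₂ + 1) (NeZero.pos N)
    omega
  · rw [← coe_tileNbhdFinset]
    exact (h₂ _ (by omega)).isRegular

theorem PowRegular.diffInj_tiles {d N f : ℕ} [NeZero N] {T : QCA (Lat s) d}
    (h : PowRegular T N f) :
    DiffInj (wrap s f) (tileNbhdFinset s N (nbhdPow T.nbhd N) : Set (Lat s)) := by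
  have := h.2
  rw [← coe_tileNbhdFinset] at this
  exact this.diffInj (Finset.finite_toSet _)

theorem PowRegular.exists_isWrapped {d N f : ℕ} [NeZero N] [NeZero f] (hd : 2 ≤ d)
    {T : QCA (Lat s) d} (h : PowRegular T N f) :
    ∃ Tw : FinQCA (Torus s (N * f)) d, IsWrapped T Tw := by
  have : NeZero d := ⟨by omega⟩
  refine QCAutomata.exists_isWrapped T (DiffInj.isRegular ?_)
  have h1 := h.1.diffInj (Finset.finite_toSet _)
  obtain ⟨n, rfl⟩ := Nat.exists_eq_succ_of_ne_zero (NeZero.ne N)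
  rw [nbhdPow, Finset.coe_add] at h1
  exact h1.of_add (Finset.coe_nonempty.2 (nbhdPow_nonempty (T.nbhd_nonempty hd) n))

end Regularity

/-! ### The two directions of the equivalence. -/

section Renormalisation

variable {s d N d' f : ℕ} [NeZero N] [NeZero f]

theorem bigProj_eq_reindex (Proj₀ : Matrix (TileConfig s N d) (TileConfig s N d) ℂ) :
    bigProj f Proj₀ = reindexStar (tileEquiv s N f d) (tens fun _ => Proj₀) := rfl

theorem embedV_eq_reindex (J₀ : Matrix (Fin d') (TileConfig s N d) ℂ)
    (A : MatAlg (Torus s f) d') :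
    embedV f J₀ A = reindexStar (tileEquiv s N f d)
      ((tens fun _ : Torus s f => J₀)ᴴ * A * tens fun _ : Torus s f => J₀) := by
  have h1 : bigJ f J₀ = (tens fun _ : Torus s f => J₀).submatrix (Equiv.refl _)
    (tileEquiv s N f d) := rfl
  rw [embedV, h1, reindexStar_apply, Matrix.conjTranspose_submatrix,
    ← Matrix.submatrix_mul_equiv _ _ _ (Equiv.refl _) _,
    ← Matrix.submatrix_mul_equiv _ _ _ (Equiv.refl _) _]
  rfl

theorem coarse_fixes_of_commute {Proj₀ : Matrix (TileConfig s N d) (TileConfig s N d) ℂ}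
    {Tw : FinQCA (Torus s (N * f)) d} {U : MatAlg (Torus s (N * f)) d}
    (hU : U ∈ Matrix.unitaryGroup (Config (Torus s (N * f)) d) ℂ)
    (hTU : ∀ A : MatAlg (Torus s (N * f)) d, Tw.toEquiv^[N] A = Uᴴ * A * U)
    (hUP : U * bigProj f Proj₀ = bigProj f Proj₀ * U) :
    coarse Tw (tens fun _ => Proj₀) = tens fun _ => Proj₀ := by
  refine EquivLike.injective (reindexStar (tileEquiv s N f d)) ?_
  rw [reindex_coarse, ← bigProj_eq_reindex, hTU, Matrix.mul_assoc, ← hUP, ← Matrix.mul_assoc,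
    ← Matrix.star_eq_conjTranspose, Matrix.mem_unitaryGroup_iff'.1 hU, Matrix.one_mul]

/-- A renormalisation implies that the projection commutes with the evolution. -/
theorem commutesOnSomeTorus_of_isRenormalisation {T : QCA (Lat s) d} {S : QCA (Lat s) d'}
    {Proj₀ : Matrix (TileConfig s N d) (TileConfig s N d) ℂ}
    {J₀ : Matrix (Fin d') (TileConfig s N d) ℂ} (hJ : IsCoarseIsometry Proj₀ J₀)
    (hS : IsRenormalisation T S J₀) : CommutesOnSomeTorus T Proj₀ := by
  obtain ⟨f, hf, hreg⟩ := exists_powRegular (N := N) T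
  obtain ⟨Tw, Sw, hTw, -, heq⟩ := hS f hreg
  obtain ⟨U, hU, hTU⟩ := exists_unitary_of_starAlgEquiv (iterEquiv Tw.toEquiv N)
  have hTU' : ∀ A : MatAlg (Torus s (N * f)) d, Tw.toEquiv^[N] A = Uᴴ * A * U := fun A => by
    rw [← iterEquiv_apply, hTU]
  refine ⟨f, hf, hreg, Tw, hTw, U, hU, hTU', ?_⟩
  -- The intertwining relation is needed only at the identity.
  have hV : embedV f J₀ (1 : MatAlg (Torus s f) d') = bigProj f Proj₀ := by
    rw [embedV_eq_reindex, Matrix.mul_one, tens_conjTranspose_mul, hJ.1, bigProj_eq_reindex]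
  have h1 := heq 1
  rw [map_one, hV, hTU'] at h1
  calc U * bigProj f Proj₀ = U * (Uᴴ * bigProj f Proj₀ * U) := by rw [h1]
    _ = (U * star U) * bigProj f Proj₀ * U := by
      rw [Matrix.star_eq_conjTranspose]; simp only [Matrix.mul_assoc]
    _ = bigProj f Proj₀ * U := by rw [Matrix.mem_unitaryGroup_iff.1 hU, Matrix.one_mul]

/-- The trivial case of cells of dimension zero. -/
theorem exists_isRenormalisation_zero (hd : 2 ≤ d) (T : QCA (Lat s) d)
    (J₀ : Matrix (Fin 0) (TileConfig s N d) ℂ) :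
    ∃ S : QCA (Lat s) 0, IsRenormalisation T S J₀ := by
  have hC : IsEmpty (Config (Lat s) 0) := ⟨fun c => (c 0).elim0⟩
  have hH : Subsingleton (HSpace (Lat s) 0) := ⟨fun a b => lp.ext (funext fun c => hC.elim c)⟩
  have hB : Subsingleton (BOp (Lat s) 0) := ⟨fun a b => ContinuousLinearMap.ext fun _ =>
    Subsingleton.elim _ _⟩
  -- There are no configurations, so the algebra is zero and every condition on S is vacuous or an
  -- equation in it.
  let S : QCA (Lat s) 0 :=
    { toEquiv := StarAlgEquiv.refl ℂ _
      nbhd := ∅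
      locality := fun Ω a _ => ⟨0, Subsingleton.elim _ _⟩
      homogeneity := fun x a => Subsingleton.elim _ _ }
  refine ⟨S, fun f _ hreg => ?_⟩
  obtain ⟨Tw, hTw⟩ := hreg.exists_isWrapped hd
  have hC' : IsEmpty (Config (Torus s f) 0) := ⟨fun c => (c 0).elim0⟩
  have hM : Subsingleton (MatAlg (Torus s f) 0) := ⟨fun a b => Matrix.ext fun c => hC'.elim c⟩
  let Sw : FinQCA (Torus s f) 0 :=
    { toEquiv := StarAlgEquiv.refl ℂ _
      nbhd := ∅
      locality := fun Ω a _ => ⟨0, Subsingleton.elim _ _⟩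
      homogeneity := fun x a => Subsingleton.elim _ _ }
  refine ⟨Tw, Sw, hTw, ⟨?_, rfl, fun a => ⟨0, Subsingleton.elim _ _, Subsingleton.elim _ _⟩⟩,
    fun A => ?_⟩
  · rintro x y ⟨z, ⟨n, hn, -⟩, -⟩
    simp [S] at hn
  · have h0 : ∀ A : MatAlg (Torus s f) 0, embedV f J₀ A = 0 := fun A => by
      rw [Subsingleton.elim A 0, embedV, Matrix.mul_zero, Matrix.zero_mul]
    rw [h0, h0, ← iterEquiv_apply, map_zero]

/-- If the projection commutes with the evolution on one wrapped lattice, there is a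
renormalisation. -/
theorem exists_isRenormalisation (hd : 2 ≤ d) [NeZero d'] {T : QCA (Lat s) d}
    {Proj₀ : Matrix (TileConfig s N d) (TileConfig s N d) ℂ} (hProj : IsStarProjection Proj₀)
    {J₀ : Matrix (Fin d') (TileConfig s N d) ℂ} (hJ : IsCoarseIsometry Proj₀ J₀)
    (h : CommutesOnSomeTorus T Proj₀) : ∃ S : QCA (Lat s) d', IsRenormalisation T S J₀ := by
  obtain ⟨hJ₁, hJ₂⟩ := hJ
  subst hJ₁
  have hp : J₀ᴴ * J₀ ≠ 0 := by
    intro h0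
    have h1 : J₀ = 0 := by
      calc J₀ = J₀ * J₀ᴴ * J₀ := by rw [hJ₂, Matrix.one_mul]
        _ = 0 := by rw [Matrix.mul_assoc, h0, Matrix.mul_zero]
    rw [h1, Matrix.zero_mul] at hJ₂
    exact zero_ne_one hJ₂
  obtain ⟨Θ, hΘ⟩ := exists_coarse_rule (N := N) hd T
  have hne : (tileNbhdFinset s N (nbhdPow T.nbhd N)).Nonempty :=
    tileNbhdFinset_nonempty (nbhdPow_nonempty (T.nbhd_nonempty hd) N)
  generalize hPdef : tileNbhdFinset s N (nbhdPow T.nbhd N) = P at Θ hΘ hne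
  have hdiff : ∀ {f : ℕ}, PowRegular T N f → DiffInj (wrap s f) (P : Set (Lat s)) :=
    fun hreg => hPdef ▸ hreg.diffInj_tiles
  have hinj : ∀ {f : ℕ}, PowRegular T N f → ∀ x : Torus s f,
      Function.Injective fun n : {n // n ∈ P} => wrap s f n + x := fun hreg x u v h =>
    Subtype.ext ((hdiff hreg).injOn u.2 v.2 (add_right_cancel h))
  obtain ⟨f₀, hf₀, hreg₀, Tw₀, hTw₀, U, hU, hTU, hUP⟩ := h
  have hfix₀ := coarse_fixes_of_commute hU hTU hUP
  -- The commutation on the given torus, reduced to a statement about the rule alone; this is what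
  -- moves to other tori.
  have hlocal : Θ (J₀ᴴ * J₀) * tens (fun _ : {n // n ∈ P} => J₀ᴴ * J₀)
      = tens fun _ : {n // n ∈ P} => J₀ᴴ * J₀ := by
    rw [← emb_mul_tens_eq_iff (hinj hreg₀ 0) hp, ← hΘ f₀ Tw₀ hTw₀ (hdiff hreg₀).injOn]
    conv_lhs => rw [← hfix₀, ← map_mul]
    conv_rhs => rw [← hfix₀]
    congr 1
    rw [cell_mul_tens, hProj.isIdempotentElem.eq]
    congr 1
    exact Function.update_eq_self 0 _
  let θ : Matrix (Fin d') (Fin d') ℂ →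
      Matrix ({n // n ∈ P} → Fin d') ({n // n ∈ P} → Fin d') ℂ := fun a =>
    tens (fun _ : {n // n ∈ P} => J₀) * Θ (J₀ᴴ * a * J₀) * (tens fun _ : {n // n ∈ P} => J₀)ᴴ
  have main : ∀ (f : ℕ) [NeZero f], PowRegular T N f → ∀ Tw : FinQCA (Torus s (N * f)) d,
      IsWrapped T Tw → ∃ F : MatAlg (Torus s f) d' ≃⋆ₐ[ℂ] MatAlg (Torus s f) d',
        (∀ x a, F (cell x a) = emb (fun n : {n // n ∈ P} => wrap s f n + x) (θ a)) ∧
        ∀ A, Tw.toEquiv^[N] (embedV f J₀ A) = embedV f J₀ (F A) := by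
    intro f _ hreg Tw hTw
    have hrule := hΘ f Tw hTw (hdiff hreg).injOn
    have hfix : coarse Tw (tens fun _ => J₀ᴴ * J₀) = tens fun _ => J₀ᴴ * J₀ := by
      refine fixes_tens_of_cells _ hProj fun x => ?_
      rw [hrule, emb_mul_tens_eq_iff (hinj hreg x) hp, hlocal]
    obtain ⟨F, hF⟩ := exists_compressed_equiv (coarse Tw) (tens fun _ : Torus s f => J₀)
      (tens_mul_conjTranspose hJ₂) (by rw [tens_conjTranspose_mul, hfix])
    refine ⟨F, fun x a => ?_, fun A => ?_⟩
    · rw [(hF _).1, compressed_rule (hinj hreg x) hJ₂ _ hfix (hrule _ _)]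
    · rw [embedV_eq_reindex, embedV_eq_reindex, ← reindex_coarse, (hF A).2]
  obtain ⟨F₀, hF₀, -⟩ := main f₀ hreg₀ Tw₀ hTw₀
  -- S is built from the single torus f₀; since θ does not depend on f, it wraps correctly to all
  -- the others.
  obtain ⟨S, hS⟩ := exists_unwrapped hne (hdiff hreg₀) F₀ θ hF₀
  refine ⟨S, fun f _ hreg => ?_⟩
  obtain ⟨Tw, hTw⟩ := hreg.exists_isWrapped hd
  obtain ⟨F, hF, hFV⟩ := main f hreg Tw hTw
  obtain ⟨Sw, hSw, hSwn⟩ := exists_finQCA_of_rule F (P.image (wrap s f))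
    (fun n : {n // n ∈ P} => wrap s f n) (fun n => Finset.mem_image_of_mem _ n.2) θ hF
  refine ⟨Tw, Sw, hTw, hS f Sw (hdiff hreg).isRegular hSwn fun a => ?_, fun A => ?_⟩
  · rw [hSw, hF]
    simp only [add_zero]
  · rw [hSw, hFV]

end Renormalisation

end QCAutomata

end

theorem mainTheorem2 (s d N : ℕ) [NeZero N] (hd : 2 ≤ d) (T : QCAutomata.QCA (Fin s → ℤ) d)
    (Proj₀ : Matrix ((Fin s → Fin N) → Fin d) ((Fin s → Fin N) → Fin d) ℂ)
    (hProj : IsStarProjection Proj₀)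
    (d' : ℕ) (J₀ : Matrix (Fin d') ((Fin s → Fin N) → Fin d) ℂ)
    (hJ : QCAutomata.IsCoarseIsometry Proj₀ J₀) :
    (∃ S : QCAutomata.QCA (Fin s → ℤ) d', QCAutomata.IsRenormalisation T S J₀) ↔
      QCAutomata.CommutesOnSomeTorus T Proj₀ := by
  refine ⟨fun ⟨S, hS⟩ => QCAutomata.commutesOnSomeTorus_of_isRenormalisation hJ hS, fun h => ?_⟩
  -- Rank zero is separate: the reduction to a local condition cancels a nonzero entry of the
  -- projection.
  rcases Nat.eq_zero_or_pos d' with rfl | hd'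
  · exact QCAutomata.exists_isRenormalisation_zero hd T J₀
  · have : NeZero d' := ⟨hd'.ne'⟩
    exact QCAutomata.exists_isRenormalisation hd hProj hJ h
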